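/- All graphs are finite. A looped simple graph $G$ consists of a simple graph on a vertex set $V(G)$ together with a set of looped vertices; $N_G(v)$ denotes the set of vertices $w\neq v$ adjacent to $v$. Let $A(G)$ be the $V(G)\times V(G)$ adjacency matrix over $GF(2)$, whose diagonal entry at $v$ is $1$ exactly when $v$ is looped. The isotropic matroid $M[IAS(G)]$ is the binary matroid represented by the columns of $IAS(G)=(I\mid A(G)\mid I+A(G))$; the $v$-columns of the three blocks are labeled $\phi_G(v),\chi_G(v),\psi_G(v)$, and its ground set is $W(G)=\{\phi_G(v),\chi_G(v),\psi_G(v) : v\in V(G)\}$. The vertex triples of $G$ are the sets $\{\phi_G(v),\chi_G(v),\psi_G(v)\}$, $v\in V(G)$. A transversal is a subset of $W(G)$ containing exactly one element of each vertex triple. A transverse matroid of $G$ is the restriction of $M[IAS(G)]$ to a transversal, and a transverse circuit of $G$ is a circuit of a transverse matroid of $G$. Two graphs on the same vertex set are locally equivalent if one can be obtained from the other by a finite sequence of the following operations, $v$ being any vertex: complement the loop status of $v$; complement the adjacency status of every pair of distinct neighbors of $v$; complement the adjacency status of every pair of distinct neighbors of $v$ and the loop status of every neighbor of $v$. **Theorem.**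 Let $G$ and $H$ be (finite) looped simple graphs. Then the following conditions are equivalent. 1. $G$ and $H$ are locally equivalent up to isomorphism, i.e. $H$ is isomorphic (as a looped graph) to a graph locally equivalent to $G$. 2. There is a compatible isomorphism between the isotropic matroids of $G$ and $H$, i.e. a matroid isomorphism $M[IAS(G)]\to M[IAS(H)]$ under which the vertex triples of $G$ and of $H$ correspond. 3. There is an isomorphism between the isotropic matroids of $G$ and $H$. 4. There is a bijection $W(G)\to W(H)$ which defines isomorphisms between the transverse matroids of $G$ and those of $H$ (that is, the transverse matroids of $H$ are exactly the images of those of $G$ under the bijection). 5. There is a bijection $W(G)\to W(H)$ under which the vertex triples and the transverse circuits of $G$ and $H$ correspond. -/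

import Mathlib

/-- A looped simple graph on the vertex set `V`: a simple graph (the adjacencies between distinct
vertices) together with the set of looped vertices. Thus `Adj` and `neighborSet` ignore loops. -/
@[ext]
structure LoopedGraph (V : Type*) extends SimpleGraph V where
  /-- The set of looped vertices. -/
  loops : Set V

/-- The labels of the three columns that a vertex contributes to the matrix `IAS`. -/
inductive ColumnLabel : Type
  | phi
  | chi
  | psi
  deriving DecidableEq

instance ColumnLabel.instFintype : Fintype ColumnLabel where
  elems := {ColumnLabel.phi, ColumnLabel.chi, ColumnLabel.psi}
  complete := by intro x; cases x <;> simp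

/-- The set `W` of column labels: `(v, phi)`, `(v, chi)`, `(v, psi)` for the vertices `v`. -/
abbrev IsotropicElement (V : Type*) : Type _ := V × ColumnLabel

/-- The matroid on the column index set of a matrix: a set of indices is independent
if and only if the corresponding family of columns is linearly independent. -/
def Matrix.columnMatroid {X Y F : Type*} [Field F] [Finite Y] (A : Matrix X Y F) : Matroid Y :=
  (IndepMatroid.ofFinite (E := Set.univ) Set.finite_univ
    (fun I : Set Y => LinearIndepOn F A.col I)
    (linearIndepOn_empty F A.col)
    (fun _ _ hJ hIJ => hJ.mono hIJ)
    (by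
      intro I J hI hJ hlt
      by_contra hcon
      have hspan : ∀ e ∈ J, A.col e ∈ Submodule.span F (A.col '' I) := by
        intro e heJ
        by_cases heI : e ∈ I
        · exact Submodule.subset_span ⟨e, heI, rfl⟩
        · by_contra hne
          exact hcon ⟨e, heJ, heI, hI.insert hne⟩
      have hle : Submodule.span F (A.col '' J) ≤ Submodule.span F (A.col '' I) := by
        rw [Submodule.span_le]
        rintro _ ⟨e, he, rfl⟩
        exact hspan e he
      have hcard : ∀ K : Set Y, LinearIndepOn F A.col K →
          Module.finrank F (Submodule.span F (A.col '' K)) = K.ncard := by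
        intro K hK
        have := Fintype.ofFinite K
        have h := finrank_span_eq_card (R := F) hK
        rw [Set.image_eq_range, h, Set.ncard_eq_toFinset_card', Set.toFinset_card]
      have hfin : Module.Finite F (Submodule.span F (A.col '' I)) :=
        Module.Finite.span_of_finite F (Set.toFinite _)
      have := Submodule.finrank_mono hle
      rw [hcard I hI, hcard J hJ] at this
      omega)
    (fun _ _ => Set.subset_univ _)).matroid

theorem Matrix.columnMatroid_ground {X Y F : Type*} [Field F] [Finite Y] (A : Matrix X Y F) :
    A.columnMatroid.E = Set.univ := rfl

theorem Matrix.columnMatroid_indep_iff {X Y F : Type*} [Field F] [Finite Y] (A : Matrix X Y F)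
    (I : Set Y) : A.columnMatroid.Indep I ↔ LinearIndepOn F A.col I := by
  simp [Matrix.columnMatroid, IndepMatroid.ofFinite]

namespace IsotropicElement

/-- The vertex triple of `v`. -/
def vertexTriple {V : Type*} (v : V) : Set (IsotropicElement V) :=
  {(v, ColumnLabel.phi), (v, ColumnLabel.chi), (v, ColumnLabel.psi)}

/-- The family of all vertex triples. -/
def vertexTriples (V : Type*) : Set (Set (IsotropicElement V)) :=
  {S | ∃ v : V, S = vertexTriple v}

/-- A transversal contains precisely one element of each vertex triple. -/
def IsTransversal {V : Type*} (T : Set (IsotropicElement V)) : Prop :=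
  ∀ v : V, ∃! w, w ∈ T ∩ vertexTriple v

end IsotropicElement

namespace LoopedGraph

/-- The graph isomorphisms: bijections that preserve and reflect adjacency and loops. -/
structure Iso {V V' : Type*} (G : LoopedGraph V) (H : LoopedGraph V') extends
    G.toSimpleGraph ≃g H.toSimpleGraph where
  map_loops_iff : ∀ v : V, toFun v ∈ H.loops ↔ v ∈ G.loops

/-- The graph obtained by complementing the loop status of `v`. -/
def loopComplement {V : Type*} (G : LoopedGraph V) (v : V) : LoopedGraph V where
  toSimpleGraph := G.toSimpleGraph
  loops := symmDiff G.loops {v}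

/-- The simple local complement at `v`: the adjacency status of every pair of (distinct) neighbors
of `v` is complemented. -/
def simpleLocalComplement {V : Type*} (G : LoopedGraph V) (v : V) : LoopedGraph V where
  Adj a b := Xor (G.Adj a b) (a ≠ b ∧ G.Adj v a ∧ G.Adj v b)
  symm := ⟨fun a b h => by
    rw [G.adj_comm b a, ne_comm, and_comm (a := G.Adj v b)]
    exact h⟩
  loopless := ⟨fun a h => by simp [Xor] at h⟩
  loops := G.loops

/-- The non-simple local complement at `v`: moreover the loop status of every neighbor of `v`
is complemented. -/
def nonsimpleLocalComplement {V : Type*} (G : LoopedGraph V) (v : V) : LoopedGraph V where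
  toSimpleGraph := (G.simpleLocalComplement v).toSimpleGraph
  loops := symmDiff G.loops (G.neighborSet v)

/-- One loop complementation or local complementation. -/
def LocalStep {V : Type*} (G H : LoopedGraph V) : Prop :=
  ∃ v : V, H = G.loopComplement v ∨ H = G.simpleLocalComplement v ∨
    H = G.nonsimpleLocalComplement v

/-- `H` can be obtained from `G` by a finite sequence of loop complementations and
local complementations. -/
def LocallyEquivalent {V : Type*} (G H : LoopedGraph V) : Prop :=
  Relation.ReflTransGen LocalStep G H

/-- Local equivalence up to isomorphism. -/
def LocallyEquivalentUpToIso {V V' : Type*} (G : LoopedGraph V) (H : LoopedGraph V') : Prop :=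
  ∃ G' : LoopedGraph V, G.LocallyEquivalent G' ∧ Nonempty (G'.Iso H)

open Classical in
/-- The adjacency matrix over `GF(2)`; its diagonal records the looped vertices. -/
noncomputable def adjacencyMatrix {V : Type*} (G : LoopedGraph V) : Matrix V V (ZMod 2) :=
  Matrix.of fun u v =>
    if u = v then (if v ∈ G.loops then 1 else 0) else (if G.Adj u v then 1 else 0)

open Classical in
/-- The matrix `(I | A | I + A)`, where `A` is the adjacency matrix. -/
noncomputable def IAS {V : Type*} (G : LoopedGraph V) :
    Matrix V (IsotropicElement V) (ZMod 2) :=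
  Matrix.of fun u w =>
    match w with
    | (v, ColumnLabel.phi) => (1 : Matrix V V (ZMod 2)) u v
    | (v, ColumnLabel.chi) => G.adjacencyMatrix u v
    | (v, ColumnLabel.psi) => ((1 : Matrix V V (ZMod 2)) + G.adjacencyMatrix) u v

/-- The isotropic matroid: the binary matroid represented by `IAS`. -/
noncomputable def isotropicMatroid {V : Type*} [Finite V] (G : LoopedGraph V) :
    Matroid (IsotropicElement V) :=
  G.IAS.columnMatroid

/-- The transverse matroids: the restrictions of the isotropic matroid to the transversals. -/
def transverseMatroids {V : Type*} [Finite V] (G : LoopedGraph V) :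
    Set (Matroid (IsotropicElement V)) :=
  {N | ∃ T, IsotropicElement.IsTransversal T ∧ N = G.isotropicMatroid.restrict T}

/-- The transverse circuits: the circuits of the transverse matroids. -/
def transverseCircuits {V : Type*} [Finite V] (G : LoopedGraph V) :
    Set (Set (IsotropicElement V)) :=
  {C | ∃ N ∈ G.transverseMatroids, N.IsCircuit C}

/-- The bijection `f` is an isomorphism of isotropic matroids. -/
def IsMatroidIso {V V' : Type*} [Finite V] [Finite V'] (G : LoopedGraph V) (H : LoopedGraph V')
    (f : IsotropicElement V ≃ IsotropicElement V') : Prop :=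
  G.isotropicMatroid.mapEquiv f = H.isotropicMatroid

/-- Under the bijection `f` the vertex triples of the two graphs correspond. -/
def MatchesVertexTriples {V V' : Type*} (f : IsotropicElement V ≃ IsotropicElement V') : Prop :=
  (fun S => f '' S) '' IsotropicElement.vertexTriples V = IsotropicElement.vertexTriples V'

/-- The transverse matroids of `H` are exactly the images under `f` of those of `G`. As the matroid
`N.mapEquiv f` is the isomorphic copy of `N` on the ground set `f '' N.E`, this says that `f`
defines isomorphisms between the transverse matroids of `G` and those of `H`. -/
def MatchesTransverseMatroids {V V' : Type*} [Finite V] [Finite V'] (G : LoopedGraph V)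
    (H : LoopedGraph V') (f : IsotropicElement V ≃ IsotropicElement V') : Prop :=
  (fun N => N.mapEquiv f) '' G.transverseMatroids = H.transverseMatroids

/-- Under the bijection `f` the transverse circuits of `G` and `H` correspond. -/
def MatchesTransverseCircuits {V V' : Type*} [Finite V] [Finite V'] (G : LoopedGraph V)
    (H : LoopedGraph V') (f : IsotropicElement V ≃ IsotropicElement V') : Prop :=
  (fun C => f '' C) '' G.transverseCircuits = H.transverseCircuits

end LoopedGraph

/-! Over GF(2), a matroid isomorphism is the same thing as a coordinate bijection identifying the
kernels of the representing matrices (`isMatroidIso_iff`), so the argument works with these cycle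
spaces. Complementing a loop exchanges the chi and psi columns of the vertex. Non-simple local
complementation amounts to row operations on `IAS`, up to exchanging the phi column of the vertex
with one other column there (`cycleIso_pivotSwap`). Hence local equivalence yields compatible
isomorphisms.

Conversely, a bijection respecting vertex triples and transverse circuits identifies all cycle
vectors whose support meets each triple at most once. If it maps phi elements to phi elements, the
fundamental circuits of the phi basis reveal the adjacencies (`TransverseCycleIso.adj_iff`).
Otherwise local complementations reduce the number of vertices where another label is mapped to phi
(`TransverseCycleIso.locallyEquivalentUpToIso_of_labels`).

The deepest point is that an arbitrary isomorphism can be replaced by a compatible one. Pulling back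
the triples of the target gives a second partition of the elements into triples that are cycle
vectors. If a triple of one partition and a triple of the other share exactly two elements, the two
leftover elements are parallel and may be transposed. Otherwise the isotropy of the cycle space, in
the form of a Gram identity, forces the incidence graph of the unshared triples to contain a cube,
on which exchanging the roles of the two partitions is a symmetry of the cycle space. Each such move
makes more triples common to both partitions (`exists_preservesSubspace_isCommonFiber_ssubset`). -/

/-! ### Binary matroids and their kernel vectors -/

/-- A set of columns is independent if and only if no nonzero kernel vector is supported on it. -/
theorem Matrix.columnMatroid_indep_iff_ker {X Y F : Type*} [Field F] [Fintype Y]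
    (A : Matrix X Y F) (I : Set Y) :
    A.columnMatroid.Indep I ↔ ∀ x : Y → F, A.mulVec x = 0 → (∀ y, x y ≠ 0 → y ∈ I) → x = 0 := by
  classical
  rw [Matrix.columnMatroid_indep_iff, linearIndepOn_iff]
  have key : ∀ l : Y →₀ F, Finsupp.linearCombination F A.col l = A.mulVec l := by
    intro l
    rw [Finsupp.linearCombination_apply, Finsupp.sum_fintype _ _ (by simp)]
    ext i
    simp [Matrix.mulVec, dotProduct, Matrix.col, mul_comm]
  constructor
  · intro h x hx hI
    have := h (Finsupp.equivFunOnFinite.symm x) (by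
      rw [Finsupp.mem_supported]
      intro y hy
      exact hI y (by simpa using hy)) (by rw [key]; simpa using hx)
    ext y
    exact DFunLike.congr_fun this y
  · intro h l hl hz
    rw [key] at hz
    rw [Finsupp.mem_supported] at hl
    have := h l hz (fun y hy => hl (by simpa using hy))
    exact DFunLike.coe_injective (by simpa using this)

/-- Over `GF(2)`, if two subspaces have the same dependent sets in a family of sets that is closed
under taking subsets, then they have the same members with supports in this family. -/
theorem binary_mem_iff_of_dependent_iff {Y : Type*} [Finite Y] (C D : Submodule (ZMod 2) (Y → ZMod 2))
    (F : Set (Set Y)) (hF : ∀ I ∈ F, ∀ J ⊆ I, J ∈ F)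
    (h : ∀ I ∈ F, (∀ x ∈ C, Function.support x ⊆ I → x = 0) ↔
      (∀ x ∈ D, Function.support x ⊆ I → x = 0)) :
    ∀ x : Y → ZMod 2, Function.support x ∈ F → (x ∈ C ↔ x ∈ D) := by
  have two : ∀ a b : ZMod 2, a ≠ 0 → b ≠ 0 → a = b := by decide
  have aux : ∀ n : ℕ, ∀ x : Y → ZMod 2, (Function.support x).ncard = n →
      Function.support x ∈ F → (x ∈ C ↔ x ∈ D) := by
    intro n
    induction n using Nat.strong_induction_on with
    | _ n ih =>
      intro x hn hx
      have step : ∀ C' D' : Submodule (ZMod 2) (Y → ZMod 2),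
          ((∀ x' ∈ D', Function.support x' ⊆ Function.support x → x' = 0) →
            (∀ x' ∈ C', Function.support x' ⊆ Function.support x → x' = 0)) →
          (∀ y, (Function.support y).ncard < n → Function.support y ∈ F → (y ∈ C' ↔ y ∈ D')) →
          x ∈ C' → x ∈ D' := by
        intro C' D' h' ih' hxC
        by_contra hxD
        have hx0 : x ≠ 0 := fun h0 => hxD (h0 ▸ D'.zero_mem)
        -- The support of `x` is dependent for `D'` too, which gives a nonzero `y` in `D'` supported
        -- inside it. Over GF(2) equal supports would force `y = x`, so both `y` and `x - y` have
        -- smaller support and are covered by induction.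
        have : ¬ ∀ x' ∈ D', Function.support x' ⊆ Function.support x → x' = 0 :=
          fun h1 => hx0 (h' h1 x hxC subset_rfl)
        push Not at this
        obtain ⟨y, hyD, hys, hy0⟩ := this
        have hne : Function.support y ≠ Function.support x := by
          intro he
          apply hxD
          convert hyD
          ext i
          by_cases hi : x i = 0
          · have : i ∉ Function.support y := by rw [he]; simpa using hi
            rw [hi]; simpa using Eq.symm (not_not.mp this)
          · have : i ∈ Function.support y := by rw [he]; exact hi
            exact two _ _ hi this
        have hlt : (Function.support y).ncard < n := by
          rw [← hn]
          exact Set.ncard_lt_ncard (hys.ssubset_of_ne hne)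
        have hyC := (ih' y hlt (hF _ hx _ hys)).2 hyD
        have hsub : Function.support (x - y) ⊂ Function.support x := by
          have h1 : Function.support (x - y) ⊆ Function.support x := by
            intro i hi
            by_contra hxi
            have hyi : i ∉ Function.support y := fun h2 => hxi (hys h2)
            simp only [Function.mem_support, not_not, Pi.sub_apply] at *
            rw [hxi, hyi] at hi
            simp at hi
          refine h1.ssubset_of_ne fun he => ?_
          obtain ⟨i, hi⟩ := Function.ne_iff.1 hy0
          have hxi : i ∈ Function.support x := hys hi
          have : i ∈ Function.support (x - y) := by rw [he]; exact hxi
          exact this (by simp [two _ _ hxi hi])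
        have hlt2 : (Function.support (x - y)).ncard < n := by
          rw [← hn]
          exact Set.ncard_lt_ncard hsub
        have := (ih' _ hlt2 (hF _ hx _ hsub.subset)).1 (C'.sub_mem hxC hyC)
        exact hxD (by simpa using D'.add_mem this hyD)
      exact ⟨step C D (h _ hx).2 (fun y hy => ih _ hy y rfl),
        step D C (h _ hx).1 (fun y hy hyF => (ih _ hy y rfl hyF).symm)⟩
  exact fun x => aux _ x rfl

/-! ### The cycle space of the isotropic matroid -/

namespace LoopedGraph

open ColumnLabel

/-- The cycle space of the isotropic matroid. -/
noncomputable def cycleSpace {V : Type*} [Fintype V] (G : LoopedGraph V) :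
    Submodule (ZMod 2) (IsotropicElement V → ZMod 2) :=
  LinearMap.ker G.IAS.mulVecLin

theorem sum_columnLabel {M : Type*} [AddCommMonoid M] (f : ColumnLabel → M) :
    ∑ a, f a = f phi + f chi + f psi := by
  change ∑ a ∈ ({phi, chi, psi} : Finset ColumnLabel), f a = _
  rw [Finset.sum_insert (by simp), Finset.sum_insert (by simp), Finset.sum_singleton, add_assoc]

/-- Each psi column is the sum of the phi and chi columns of its vertex, so a vector enters the
kernel equations only through the sums phi + psi and chi + psi. -/
theorem mem_cycleSpace {V : Type*} [Fintype V] (G : LoopedGraph V)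
    (x : IsotropicElement V → ZMod 2) :
    x ∈ G.cycleSpace ↔ ∀ u, x (u, phi) + x (u, psi) +
      ∑ v, G.adjacencyMatrix u v * (x (v, chi) + x (v, psi)) = 0 := by
  classical
  rw [cycleSpace, LinearMap.mem_ker, funext_iff]
  refine forall_congr' fun u => ?_
  have : G.IAS.mulVecLin x u = x (u, phi) + x (u, psi) +
      ∑ v, G.adjacencyMatrix u v * (x (v, chi) + x (v, psi)) := by
    simp only [Matrix.mulVecLin_apply, Matrix.mulVec, dotProduct, Fintype.sum_prod_type,
      sum_columnLabel, IAS, Matrix.of_apply, Matrix.add_apply, Finset.sum_add_distrib, mul_add,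
      add_mul, Matrix.one_apply, ite_mul, one_mul, zero_mul, Finset.sum_ite_eq, Finset.mem_univ,
      if_true]
    ring
  rw [this]
  rfl

theorem isotropicMatroid_indep_iff {V : Type*} [Fintype V] (G : LoopedGraph V)
    (I : Set (IsotropicElement V)) :
    G.isotropicMatroid.Indep I ↔ ∀ x ∈ G.cycleSpace, Function.support x ⊆ I → x = 0 := by
  rw [isotropicMatroid, Matrix.columnMatroid_indep_iff_ker]
  rfl

/-- The bijection `f` identifies the cycle spaces of the isotropic matroids. -/
def CycleIso {V V' : Type*} [Fintype V] [Fintype V'] (G : LoopedGraph V) (H : LoopedGraph V')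
    (f : IsotropicElement V ≃ IsotropicElement V') : Prop :=
  ∀ x, x ∈ H.cycleSpace ↔ x ∘ f ∈ G.cycleSpace

/-- Composition with `f` maps the vectors supported in `f '' I` to the vectors supported in `I`. -/
theorem forall_support_comp_iff {Y Y' : Type*} (f : Y ≃ Y') (C : Submodule (ZMod 2) (Y → ZMod 2))
    (I : Set Y) :
    (∀ x ∈ C, Function.support x ⊆ I → x = 0) ↔
      ∀ x ∈ C.comap (LinearMap.funLeft (ZMod 2) (ZMod 2) f),
        Function.support x ⊆ f '' I → x = 0 := by
  constructor
  · intro h x hx hs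
    have := h (x ∘ f) hx (by
      intro i hi
      obtain ⟨j, hj, hji⟩ := hs (show f i ∈ Function.support x from hi)
      rwa [← f.injective hji])
    ext y
    simpa using congrFun this (f.symm y)
  · intro h x hx hs
    have := h (x ∘ f.symm) (by
      simp only [Submodule.mem_comap]
      convert hx
      ext i
      simp [LinearMap.funLeft]) (by
      intro i hi
      exact ⟨f.symm i, hs hi, by simp⟩)
    ext y
    simpa using congrFun this (f y)

/-- A binary matroid determines its cycle space: this is the comparison of dependent sets with no
restriction on the supports. -/
theorem isMatroidIso_iff {V V' : Type*} [Fintype V] [Fintype V'] (G : LoopedGraph V)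
    (H : LoopedGraph V') (f : IsotropicElement V ≃ IsotropicElement V') :
    G.IsMatroidIso H f ↔ G.CycleIso H f := by
  have key : ∀ I, (G.isotropicMatroid.mapEquiv f).Indep I ↔
      ∀ x ∈ G.cycleSpace.comap (LinearMap.funLeft (ZMod 2) (ZMod 2) f),
        Function.support x ⊆ I → x = 0 := by
    intro I
    rw [Matroid.mapEquiv_indep_iff, isotropicMatroid_indep_iff, forall_support_comp_iff f]
    simp
  constructor
  · intro h x
    refine binary_mem_iff_of_dependent_iff H.cycleSpace
      (G.cycleSpace.comap (LinearMap.funLeft (ZMod 2) (ZMod 2) f)) Set.univ (by simp) ?_ x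
      (Set.mem_univ _)
    intro I _
    rw [← isotropicMatroid_indep_iff, ← key, ← h]
  · intro h
    refine Matroid.ext_indep ?_ fun I _ => ?_
    · simp [isotropicMatroid, Matrix.columnMatroid_ground]
    · rw [key, isotropicMatroid_indep_iff]
      refine forall_congr' fun x => ?_
      rw [h x]
      rfl

end LoopedGraph

/-! ### Local operations as isomorphisms of cycle spaces -/

namespace LoopedGraph

open ColumnLabel

theorem CycleIso.trans {V V' V'' : Type*} [Fintype V] [Fintype V'] [Fintype V'']
    {G : LoopedGraph V} {H : LoopedGraph V'} {K : LoopedGraph V''}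
    {f : IsotropicElement V ≃ IsotropicElement V'} {g : IsotropicElement V' ≃ IsotropicElement V''}
    (hf : G.CycleIso H f) (hg : H.CycleIso K g) : G.CycleIso K (f.trans g) :=
  fun x => (hg x).trans (hf _)

theorem CycleIso.symm {V V' : Type*} [Fintype V] [Fintype V'] {G : LoopedGraph V}
    {H : LoopedGraph V'} {f : IsotropicElement V ≃ IsotropicElement V'} (hf : G.CycleIso H f) :
    H.CycleIso G f.symm := by
  intro x
  rw [hf]
  convert Iff.rfl
  ext i
  simp

theorem adjacencyMatrix_self {V : Type*} (G : LoopedGraph V) [DecidablePred (· ∈ G.loops)] (u : V) :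
    G.adjacencyMatrix u u = if u ∈ G.loops then 1 else 0 := by
  simp [adjacencyMatrix]

theorem adjacencyMatrix_of_ne {V : Type*} (G : LoopedGraph V) [DecidableRel G.Adj] {u v : V}
    (h : u ≠ v) : G.adjacencyMatrix u v = if G.Adj u v then 1 else 0 := by
  simp [adjacencyMatrix, h]

theorem adjacencyMatrix_symm {V : Type*} (G : LoopedGraph V) (u v : V) :
    G.adjacencyMatrix u v = G.adjacencyMatrix v u := by
  classical
  by_cases h : u = v
  · rw [h]
  · rw [adjacencyMatrix_of_ne _ h, adjacencyMatrix_of_ne _ (Ne.symm h), G.adj_comm]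

open Classical in
/-- Exchange of the `chi` and `psi` labels at the vertices in `S`. -/
noncomputable def swapChiPsi {V : Type*} (S : Set V) : IsotropicElement V ≃ IsotropicElement V :=
  Equiv.prodCongrRight fun v => if v ∈ S then Equiv.swap chi psi else Equiv.refl _

/-- Changing the loop status of a vertex adds a unit vector to its chi column, which turns it into
the former psi column and vice versa; no other column changes. -/
theorem cycleIso_swapChiPsi {V : Type*} [Fintype V] (G H : LoopedGraph V)
    (h : G.toSimpleGraph = H.toSimpleGraph) :
    G.CycleIso H (swapChiPsi (symmDiff G.loops H.loops)) := by
  classical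
  intro x
  rw [mem_cycleSpace, mem_cycleSpace]
  refine forall_congr' fun u => ?_
  rw [Fintype.sum_eq_add_sum_compl u, Fintype.sum_eq_add_sum_compl u (fun v => G.adjacencyMatrix u v * _)]
  have hsum : ∑ v ∈ {u}ᶜ, H.adjacencyMatrix u v * (x (v, chi) + x (v, psi)) =
      ∑ v ∈ {u}ᶜ, G.adjacencyMatrix u v *
        ((x ∘ swapChiPsi (symmDiff G.loops H.loops)) (v, chi) +
          (x ∘ swapChiPsi (symmDiff G.loops H.loops)) (v, psi)) := by
    refine Finset.sum_congr rfl fun v hv => ?_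
    have huv : u ≠ v := by
      rintro rfl
      simp at hv
    have : G.adjacencyMatrix u v = H.adjacencyMatrix u v := by
      rw [adjacencyMatrix_of_ne _ huv, adjacencyMatrix_of_ne _ huv, h]
    rw [this]
    by_cases hs : v ∈ symmDiff G.loops H.loops <;>
      simp [swapChiPsi, Equiv.prodCongrRight, hs, add_comm]
  rw [hsum, adjacencyMatrix_self, adjacencyMatrix_self]
  by_cases h1 : u ∈ G.loops <;> by_cases h2 : u ∈ H.loops <;>
    simp [swapChiPsi, Equiv.prodCongrRight, Set.mem_symmDiff, h1, h2, Equiv.swap_apply_def] <;>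
    grind

open Classical in
/-- The label of the column at `v` that local complementation at `v` exchanges with `phi`. -/
noncomputable def pivotLabel {V : Type*} (G : LoopedGraph V) (v : V) : ColumnLabel :=
  if v ∈ G.loops then chi else psi

open Classical in
/-- Exchange of the labels `phi` and `G.pivotLabel v` at `v`. -/
noncomputable def pivotSwap {V : Type*} (G : LoopedGraph V) (v : V) :
    IsotropicElement V ≃ IsotropicElement V :=
  Equiv.swap (v, phi) (v, G.pivotLabel v)

theorem adjacencyMatrix_nonsimpleLocalComplement {V : Type*} (G : LoopedGraph V)
    [DecidableRel G.Adj] (v u w : V) :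
    (G.nonsimpleLocalComplement v).adjacencyMatrix u w = G.adjacencyMatrix u w +
      (if G.Adj v u then 1 else 0) * (if G.Adj v w then 1 else 0) := by
  classical
  by_cases h : u = w
  · subst h
    rw [adjacencyMatrix_self, adjacencyMatrix_self]
    by_cases h1 : u ∈ G.loops <;> by_cases h2 : G.Adj v u <;>
      simp [nonsimpleLocalComplement, Set.mem_symmDiff, h1, h2] <;> decide
  · rw [adjacencyMatrix_of_ne _ h, adjacencyMatrix_of_ne _ h]
    by_cases h1 : G.Adj u w <;> by_cases h2 : G.Adj v u <;> by_cases h3 : G.Adj v w <;>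
      simp [nonsimpleLocalComplement, simpleLocalComplement, h1, h2, h3, h, Xor] <;> decide

/-- The local complement adds to the adjacency matrix the outer product of the neighborhood vector
of `v` with itself. After the exchange of labels at `v`, this adds the kernel equation of `v` to
those of its neighbors, so the solutions are the same. -/
theorem cycleIso_pivotSwap {V : Type*} [Fintype V] (G : LoopedGraph V) (v : V) :
    G.CycleIso (G.nonsimpleLocalComplement v) (G.pivotSwap v) := by
  classical
  intro x
  rw [mem_cycleSpace, mem_cycleSpace]
  have hoff : ∀ u a, u ≠ v → (x ∘ G.pivotSwap v) (u, a) = x (u, a) := by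
    intro u a hu
    simp only [Function.comp_apply, pivotSwap]
    rw [Equiv.swap_apply_of_ne_of_ne] <;> simp [hu]
  set N : V → ZMod 2 := fun u => if G.Adj v u then 1 else 0 with hN
  set σ : ZMod 2 := ∑ w ∈ {v}ᶜ, N w * (x (w, chi) + x (w, psi)) with hσ
  set ρ : V → ZMod 2 := fun u =>
    ∑ w ∈ {v}ᶜ, G.adjacencyMatrix u w * (x (w, chi) + x (w, psi)) with hρ
  have hNv : N v = 0 := by simp [hN]
  have hGN : ∀ u, u ≠ v → G.adjacencyMatrix u v = N u := by
    intro u hu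
    rw [adjacencyMatrix_of_ne _ hu, G.adj_comm]
  have hρv : ρ v = σ := by
    refine Finset.sum_congr rfl fun w hw => ?_
    have : w ≠ v := by simpa using hw
    rw [adjacencyMatrix_symm, hGN w this]
  have hL : ∀ u, ∑ w, (G.nonsimpleLocalComplement v).adjacencyMatrix u w *
      (x (w, chi) + x (w, psi)) =
      G.adjacencyMatrix u v * (x (v, chi) + x (v, psi)) + ρ u + N u * σ := by
    intro u
    rw [Fintype.sum_eq_add_sum_compl v, hσ, Finset.mul_sum, add_assoc, ← Finset.sum_add_distrib]
    congr 1
    · rw [adjacencyMatrix_nonsimpleLocalComplement]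
      simp
    · refine Finset.sum_congr rfl fun w _ => ?_
      rw [adjacencyMatrix_nonsimpleLocalComplement]
      ring
  have hR : ∀ u, ∑ w, G.adjacencyMatrix u w *
      ((x ∘ G.pivotSwap v) (w, chi) + (x ∘ G.pivotSwap v) (w, psi)) =
      G.adjacencyMatrix u v *
        ((x ∘ G.pivotSwap v) (v, chi) + (x ∘ G.pivotSwap v) (v, psi)) + ρ u := by
    intro u
    rw [Fintype.sum_eq_add_sum_compl v]
    congr 1
    refine Finset.sum_congr rfl fun w hw => ?_
    have : w ≠ v := by simpa using hw
    rw [hoff _ _ this, hoff _ _ this]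
  simp only [hL, hR]
  -- The equation at `v` is symmetric in the two exchanged labels, hence literally the same in both
  -- systems.
  have hv : x (v, phi) + x (v, psi) +
      (G.adjacencyMatrix v v * (x (v, chi) + x (v, psi)) + ρ v + N v * σ) =
      (x ∘ G.pivotSwap v) (v, phi) + (x ∘ G.pivotSwap v) (v, psi) +
      (G.adjacencyMatrix v v *
        ((x ∘ G.pivotSwap v) (v, chi) + (x ∘ G.pivotSwap v) (v, psi)) + ρ v) := by
    rw [hNv, adjacencyMatrix_self]
    by_cases h1 : v ∈ G.loops <;>
      simp [pivotSwap, pivotLabel, h1, Equiv.swap_apply_def] <;> ring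
  -- Granted the equation at `v`, the correction in the row of a neighbor is precisely the effect of
  -- the exchange of labels.
  have hu : x (v, phi) + x (v, psi) +
      (G.adjacencyMatrix v v * (x (v, chi) + x (v, psi)) + ρ v + N v * σ) = 0 →
      σ + (x (v, chi) + x (v, psi)) =
        (x ∘ G.pivotSwap v) (v, chi) + (x ∘ G.pivotSwap v) (v, psi) := by
    intro h
    rw [hNv, hρv, adjacencyMatrix_self] at h
    by_cases h1 : v ∈ G.loops <;>
      simp [pivotSwap, pivotLabel, h1, Equiv.swap_apply_def] at h ⊢ <;> grind
  have hu' : x (v, phi) + x (v, psi) +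
      (G.adjacencyMatrix v v * (x (v, chi) + x (v, psi)) + ρ v + N v * σ) = 0 →
      ∀ u, x (u, phi) + x (u, psi) +
      (G.adjacencyMatrix u v * (x (v, chi) + x (v, psi)) + ρ u + N u * σ) =
      (x ∘ G.pivotSwap v) (u, phi) + (x ∘ G.pivotSwap v) (u, psi) +
      (G.adjacencyMatrix u v *
        ((x ∘ G.pivotSwap v) (v, chi) + (x ∘ G.pivotSwap v) (v, psi)) + ρ u) := by
    intro h u
    by_cases huv : u = v
    · rw [huv, hv]
    · rw [hoff _ _ huv, hoff _ _ huv, ← hu h, hGN u huv]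
      ring
  constructor
  · intro h u
    rw [← hu' (h v)]
    exact h u
  · intro h u
    have h0 := h v
    rw [← hv] at h0
    rw [hu' h0]
    exact h u

/-- The bijection of elements induced by a bijection of vertices. -/
def vertexMap {V V' : Type*} (π : V ≃ V') : IsotropicElement V ≃ IsotropicElement V' :=
  Equiv.prodCongr π (Equiv.refl _)

theorem Iso.cycleIso {V V' : Type*} [Fintype V] [Fintype V'] {G : LoopedGraph V}
    {H : LoopedGraph V'} (π : G.Iso H) : G.CycleIso H (vertexMap π.toEquiv) := by
  classical
  have hA : ∀ u v, H.adjacencyMatrix (π.toEquiv u) (π.toEquiv v) = G.adjacencyMatrix u v := by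
    intro u v
    by_cases h : u = v
    · subst h
      rw [adjacencyMatrix_self, adjacencyMatrix_self]
      exact if_congr (π.map_loops_iff u) rfl rfl
    · rw [adjacencyMatrix_of_ne _ h, adjacencyMatrix_of_ne _ (fun h' => h (π.toEquiv.injective h'))]
      exact if_congr π.map_rel_iff' rfl rfl
  intro x
  rw [mem_cycleSpace, mem_cycleSpace, ← π.toEquiv.forall_congr_right]
  refine forall_congr' fun u => ?_
  rw [← π.toEquiv.sum_comp]
  simp only [hA]
  rfl

/-- The bijection `f` maps two elements to the same vertex if and only if they have the same
vertex. -/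
def Compatible {V V' : Type*} (f : IsotropicElement V ≃ IsotropicElement V') : Prop :=
  ∀ w w', (f w).1 = (f w').1 ↔ w.1 = w'.1

theorem Compatible.trans {V V' V'' : Type*} {f : IsotropicElement V ≃ IsotropicElement V'}
    {g : IsotropicElement V' ≃ IsotropicElement V''} (hf : Compatible f) (hg : Compatible g) :
    Compatible (f.trans g) :=
  fun w w' => (hg _ _).trans (hf w w')

theorem Compatible.symm {V V' : Type*} {f : IsotropicElement V ≃ IsotropicElement V'}
    (hf : Compatible f) : Compatible f.symm := by
  intro w w'
  rw [← hf]
  simp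

theorem compatible_of_fst {V : Type*} {f : IsotropicElement V ≃ IsotropicElement V}
    (h : ∀ w, (f w).1 = w.1) : Compatible f :=
  fun w w' => by rw [h, h]

theorem swapChiPsi_fst {V : Type*} (S : Set V) (w : IsotropicElement V) :
    (swapChiPsi S w).1 = w.1 := rfl

theorem pivotSwap_fst {V : Type*} (G : LoopedGraph V) (v : V) (w : IsotropicElement V) :
    (G.pivotSwap v w).1 = w.1 := by
  classical
  simp only [pivotSwap, Equiv.swap_apply_def]
  split_ifs with h1 h2 <;> simp [*]

theorem compatible_vertexMap {V V' : Type*} (π : V ≃ V') : Compatible (vertexMap π) :=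
  fun w w' => by simp [vertexMap]

theorem LocallyEquivalent.exists_cycleIso {V : Type*} [Fintype V] {G H : LoopedGraph V}
    (h : G.LocallyEquivalent H) : ∃ f, G.CycleIso H f ∧ Compatible f := by
  induction h with
  | refl => exact ⟨Equiv.refl _, fun x => Iff.rfl, fun _ _ => Iff.rfl⟩
  | tail _ hs ih =>
    obtain ⟨f, hf, hc⟩ := ih
    obtain ⟨v, rfl | rfl | rfl⟩ := hs
    · exact ⟨_, hf.trans (cycleIso_swapChiPsi _ (loopComplement _ v) rfl),
        hc.trans (compatible_of_fst (swapChiPsi_fst _))⟩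
    -- The simple local complement differs from the non-simple one only in its loops.
    · exact ⟨_, (hf.trans (cycleIso_pivotSwap _ v)).trans
        (cycleIso_swapChiPsi _ (simpleLocalComplement _ v) rfl),
        (hc.trans (compatible_of_fst (pivotSwap_fst _ v))).trans
          (compatible_of_fst (swapChiPsi_fst _))⟩
    · exact ⟨_, hf.trans (cycleIso_pivotSwap _ v), hc.trans (compatible_of_fst (pivotSwap_fst _ v))⟩

theorem LocallyEquivalentUpToIso.exists_cycleIso {V V' : Type*} [Fintype V] [Fintype V']
    {G : LoopedGraph V} {H : LoopedGraph V'} (h : G.LocallyEquivalentUpToIso H) :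
    ∃ f, G.CycleIso H f ∧ Compatible f := by
  obtain ⟨G', hG, ⟨π⟩⟩ := h
  obtain ⟨f, hf, hc⟩ := hG.exists_cycleIso
  exact ⟨_, hf.trans π.cycleIso, hc.trans (compatible_vertexMap _)⟩

theorem locallyEquivalent_of_toSimpleGraph_eq {V : Type*} [Finite V] (G H : LoopedGraph V)
    (h : G.toSimpleGraph = H.toSimpleGraph) : G.LocallyEquivalent H := by
  have aux : ∀ S : Set V, G.LocallyEquivalent ⟨G.toSimpleGraph, symmDiff G.loops S⟩ := by
    intro S
    induction S, Set.toFinite S using Set.Finite.induction_on with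
    | empty =>
      rw [← Set.bot_eq_empty, symmDiff_bot]
      exact Relation.ReflTransGen.refl
    | @insert v S hv _ ih =>
      refine ih.tail ⟨v, Or.inl ?_⟩
      ext1
      · rfl
      · change symmDiff G.loops (insert v S) = symmDiff (symmDiff G.loops S) {v}
        rw [symmDiff_assoc, (show Disjoint S {v} by simpa using hv).symmDiff_eq_sup]
        exact congrArg _ (Set.union_comm _ _)
  have := aux (symmDiff G.loops H.loops)
  rwa [symmDiff_symmDiff_cancel_left, h] at this

end LoopedGraph

/-! ### Vertex triples, subtransversals and transverse circuits -/

namespace LoopedGraph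

open ColumnLabel IsotropicElement

theorem mem_vertexTriple {V : Type*} {v : V} {w : IsotropicElement V} :
    w ∈ vertexTriple v ↔ w.1 = v := by
  obtain ⟨u, a⟩ := w
  cases a <;> simp [vertexTriple]

theorem matchesVertexTriples_iff {V V' : Type*} (f : IsotropicElement V ≃ IsotropicElement V') :
    MatchesVertexTriples f ↔ Compatible f := by
  constructor
  · intro h w w'
    constructor
    · intro he
      have : vertexTriple (f w).1 ∈ (fun S => f '' S) '' vertexTriples V := by
        rw [h]
        exact ⟨_, rfl⟩
      obtain ⟨_, ⟨v, rfl⟩, hv⟩ := this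
      have h1 : f w ∈ f '' vertexTriple v := by
        simp only [hv, mem_vertexTriple]
      have h2 : f w' ∈ f '' vertexTriple v := by
        simp only [hv, mem_vertexTriple, he]
      rw [f.injective.mem_set_image, mem_vertexTriple] at h1 h2
      rw [h1, h2]
    · intro he
      have : f '' vertexTriple w.1 ∈ vertexTriples V' := by
        rw [← h]
        exact ⟨_, ⟨_, rfl⟩, rfl⟩
      obtain ⟨v, hv⟩ := this
      have h1 : f w ∈ vertexTriple v := by
        rw [← hv, f.injective.mem_set_image, mem_vertexTriple]
      have h2 : f w' ∈ vertexTriple v := by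
        rw [← hv, f.injective.mem_set_image, mem_vertexTriple, he]
      rw [mem_vertexTriple] at h1 h2
      rw [h1, h2]
  · intro h
    have key : ∀ w, f '' vertexTriple w.1 = vertexTriple (f w).1 := by
      intro w
      ext x
      obtain ⟨y, rfl⟩ := f.surjective x
      rw [f.injective.mem_set_image, mem_vertexTriple, mem_vertexTriple, h]
    ext S
    constructor
    · rintro ⟨_, ⟨v, rfl⟩, rfl⟩
      exact ⟨_, key (v, phi)⟩
    · rintro ⟨v, rfl⟩
      refine ⟨_, ⟨(f.symm (v, phi)).1, rfl⟩, ?_⟩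
      have := key (f.symm (v, phi))
      simpa using this

/-- The set `I` contains at most one element of each vertex triple. -/
def IsSubtransversal {V : Type*} (I : Set (IsotropicElement V)) : Prop :=
  ∀ w ∈ I, ∀ w' ∈ I, w.1 = w'.1 → w = w'

theorem IsSubtransversal.mono {V : Type*} {I J : Set (IsotropicElement V)}
    (hI : IsSubtransversal I) (h : J ⊆ I) : IsSubtransversal J :=
  fun w hw w' hw' => hI w (h hw) w' (h hw')

theorem isSubtransversal_of_isTransversal {V : Type*} {T : Set (IsotropicElement V)}
    (hT : IsTransversal T) : IsSubtransversal T := fun w hw _ hw' h =>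
  (hT w.1).unique ⟨hw, mem_vertexTriple.2 rfl⟩ ⟨hw', mem_vertexTriple.2 h.symm⟩

theorem IsSubtransversal.exists_isTransversal {V : Type*} {I : Set (IsotropicElement V)}
    (hI : IsSubtransversal I) : ∃ T, IsTransversal T ∧ I ⊆ T := by
  -- The vertices missed by `I` are filled in with their phi elements.
  refine ⟨I ∪ {w | w.2 = phi ∧ ∀ w' ∈ I, w'.1 ≠ w.1}, fun v => ?_, Set.subset_union_left⟩
  by_cases h : ∃ w ∈ I, w.1 = v
  · obtain ⟨w, hw, rfl⟩ := h
    refine ⟨w, ⟨Or.inl hw, mem_vertexTriple.2 rfl⟩, ?_⟩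
    rintro y ⟨hy | hy, hyv⟩
    · exact hI _ hy _ hw (mem_vertexTriple.1 hyv)
    · exact absurd (mem_vertexTriple.1 hyv).symm (hy.2 w hw)
  · push Not at h
    refine ⟨(v, phi), ⟨Or.inr ⟨rfl, h⟩, mem_vertexTriple.2 rfl⟩, ?_⟩
    rintro y ⟨hy | hy, hyv⟩
    · exact absurd (mem_vertexTriple.1 hyv) (h y hy)
    · exact Prod.ext (mem_vertexTriple.1 hyv) hy.1

theorem Compatible.isSubtransversal_image {V V' : Type*}
    {f : IsotropicElement V ≃ IsotropicElement V'} (hf : Compatible f)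
    {I : Set (IsotropicElement V)} (hI : IsSubtransversal I) : IsSubtransversal (f '' I) := by
  rintro _ ⟨w, hw, rfl⟩ _ ⟨w', hw', rfl⟩ h
  rw [hI w hw w' hw' ((hf _ _).1 h)]

theorem mem_transverseCircuits {V : Type*} [Finite V] (G : LoopedGraph V)
    (C : Set (IsotropicElement V)) :
    C ∈ G.transverseCircuits ↔ G.isotropicMatroid.IsCircuit C ∧ IsSubtransversal C := by
  constructor
  · rintro ⟨_, ⟨T, hT, rfl⟩, hC⟩
    rw [Matroid.restrict_isCircuit_iff (Set.subset_univ _)] at hC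
    exact ⟨hC.1, (isSubtransversal_of_isTransversal hT).mono hC.2⟩
  · rintro ⟨hC, hs⟩
    obtain ⟨T, hT, hCT⟩ := hs.exists_isTransversal
    exact ⟨_, ⟨T, hT, rfl⟩, (Matroid.restrict_isCircuit_iff (Set.subset_univ _)).2 ⟨hC, hCT⟩⟩

/-- A circuit inside a subtransversal is itself a subtransversal, so the transverse circuits alone
decide independence here. -/
theorem IsSubtransversal.indep_iff {V : Type*} [Finite V] (G : LoopedGraph V)
    {I : Set (IsotropicElement V)} (hI : IsSubtransversal I) :
    G.isotropicMatroid.Indep I ↔ ∀ C ∈ G.transverseCircuits, ¬ C ⊆ I := by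
  rw [Matroid.indep_iff_forall_subset_not_isCircuit (Set.subset_univ _)]
  constructor
  · exact fun h C hC hCI => h C hCI ((mem_transverseCircuits _ _).1 hC).1
  · exact fun h C hCI hC => h C ((mem_transverseCircuits _ _).2 ⟨hC, hI.mono hCI⟩) hCI

/-- The bijection `f` identifies the members of the cycle spaces with subtransversal supports. -/
def TransverseCycleIso {V V' : Type*} [Fintype V] [Fintype V'] (G : LoopedGraph V)
    (H : LoopedGraph V') (f : IsotropicElement V ≃ IsotropicElement V') : Prop :=
  ∀ x, IsSubtransversal (Function.support x) → (x ∈ H.cycleSpace ↔ x ∘ f ∈ G.cycleSpace)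

/-- Subtransversals are closed under taking subsets, so the uniqueness of binary cycle spaces can be
applied within this family, where transverse circuits control independence. -/
theorem MatchesTransverseCircuits.transverseCycleIso {V V' : Type*} [Fintype V] [Fintype V']
    {G : LoopedGraph V} {H : LoopedGraph V'} {f : IsotropicElement V ≃ IsotropicElement V'}
    (h : G.MatchesTransverseCircuits H f) (hf : Compatible f) : G.TransverseCycleIso H f := by
  refine binary_mem_iff_of_dependent_iff H.cycleSpace
    (G.cycleSpace.comap (LinearMap.funLeft (ZMod 2) (ZMod 2) f)) {I | IsSubtransversal I}
    (fun I hI J hJ => IsSubtransversal.mono hI hJ) fun I hI => ?_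
  have hI' : IsSubtransversal (f.symm '' I) := hf.symm.isSubtransversal_image hI
  have h1 := forall_support_comp_iff f G.cycleSpace (f.symm '' I)
  rw [← isotropicMatroid_indep_iff, hI'.indep_iff] at h1
  rw [← isotropicMatroid_indep_iff, IsSubtransversal.indep_iff H hI, ← h]
  simp only [Equiv.image_symm_image] at h1
  have h2 : (∀ C ∈ (fun C => f '' C) '' G.transverseCircuits, ¬ C ⊆ I) ↔
      ∀ C ∈ G.transverseCircuits, ¬ C ⊆ f.symm '' I := by
    rw [Set.forall_mem_image]
    simp [Equiv.image_symm_eq_preimage]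
  rw [h2, h1]

theorem CycleIso.transverseCycleIso_trans {V V' V'' : Type*} [Fintype V] [Fintype V'] [Fintype V'']
    {G : LoopedGraph V} {H : LoopedGraph V'} {K : LoopedGraph V''}
    {f : IsotropicElement V ≃ IsotropicElement V'} {g : IsotropicElement V' ≃ IsotropicElement V''}
    (hf : G.CycleIso H f) (hg : H.TransverseCycleIso K g) : G.TransverseCycleIso K (f.trans g) :=
  fun x hx => (hg x hx).trans (hf _)

/-! ### From transverse circuits to local equivalence -/

open Classical in
/-- The label at `v`, other than `phi` and `G.pivotLabel v`. -/
noncomputable def coPivotLabel {V : Type*} (G : LoopedGraph V) (v : V) : ColumnLabel :=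
  if v ∈ G.loops then psi else chi

theorem eq_phi_or_pivotLabel_or_coPivotLabel {V : Type*} (G : LoopedGraph V) (v : V)
    (a : ColumnLabel) : a = phi ∨ a = G.pivotLabel v ∨ a = G.coPivotLabel v := by
  unfold pivotLabel coPivotLabel
  cases a <;> split_ifs <;> simp

theorem coPivotLabel_ne_phi {V : Type*} (G : LoopedGraph V) (v : V) : G.coPivotLabel v ≠ phi := by
  unfold coPivotLabel
  split_ifs <;> simp

open Classical in
/-- The indicator function of the fundamental circuit of `(v, G.coPivotLabel v)` with respect to
the basis of all elements labeled `phi`. -/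
noncomputable def neighborhoodCircuit {V : Type*} (G : LoopedGraph V) (v : V) :
    IsotropicElement V → ZMod 2 := fun w =>
  if w.2 = phi then (if G.Adj v w.1 then 1 else 0)
  else if w = (v, G.coPivotLabel v) then 1 else 0

/-- The co-pivot label selects, of the chi and psi columns of `v`, the one with a zero in row `v`.
That column is the sum of the phi columns of the neighbors of `v`. -/
theorem neighborhoodCircuit_mem {V : Type*} [Fintype V] (G : LoopedGraph V) (v : V) :
    G.neighborhoodCircuit v ∈ G.cycleSpace := by
  classical
  rw [mem_cycleSpace]
  intro u
  have h : ∀ w, G.neighborhoodCircuit v (w, chi) + G.neighborhoodCircuit v (w, psi) =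
      if w = v then 1 else 0 := by
    intro w
    by_cases hw : w = v <;> by_cases hl : v ∈ G.loops <;>
      simp [neighborhoodCircuit, coPivotLabel, hl, hw]
  simp only [h, mul_ite, mul_one, mul_zero, Finset.sum_ite_eq', Finset.mem_univ, if_true]
  by_cases huv : u = v
  · subst huv
    rw [adjacencyMatrix_self]
    by_cases hl : u ∈ G.loops <;>
      simp [neighborhoodCircuit, coPivotLabel, hl] <;> decide
  · rw [adjacencyMatrix_of_ne _ huv, G.adj_comm]
    by_cases ha : G.Adj v u <;> simp [neighborhoodCircuit, huv, ha] <;> decide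

theorem isSubtransversal_support_neighborhoodCircuit {V : Type*} (G : LoopedGraph V) (v : V) :
    IsSubtransversal (Function.support (G.neighborhoodCircuit v)) := by
  classical
  have key : ∀ w, G.neighborhoodCircuit v w ≠ 0 →
      (w.2 = phi ∧ w.1 ≠ v) ∨ w = (v, G.coPivotLabel v) := by
    intro w hw
    unfold neighborhoodCircuit at hw
    split_ifs at hw with h1 h2 h3
    · exact Or.inl ⟨h1, h2.ne'⟩
    · simp at hw
    · exact Or.inr h3
    · simp at hw
  intro w hw w' hw' h
  rcases key w hw with h1 | h1 <;> rcases key w' hw' with h2 | h2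
  · exact Prod.ext h (h1.1.trans h2.1.symm)
  · exact absurd (h.trans (congrArg Prod.fst h2)) h1.2
  · exact absurd (h.symm.trans (congrArg Prod.fst h1)) h2.2
  · rw [h1, h2]

theorem pivotSwap_apply_of_ne {V : Type*} (G : LoopedGraph V) {u v : V} (h : u ≠ v)
    (a : ColumnLabel) : G.pivotSwap v (u, a) = (u, a) := by
  classical
  unfold pivotSwap
  rw [Equiv.swap_apply_of_ne_of_ne] <;> simp [h]

theorem pivotSwap_symm {V : Type*} (G : LoopedGraph V) (v : V) :
    (G.pivotSwap v).symm = G.pivotSwap v := by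
  classical
  exact Equiv.symm_swap _ _

/-- Local complementation at a neighbor toggles the loop at `v`. This makes available a pivot at `v`
that exchanges phi with the label previously out of reach. -/
theorem pivotLabel_nonsimpleLocalComplement {V : Type*} (G : LoopedGraph V) {v w : V}
    (h : G.Adj w v) : (G.nonsimpleLocalComplement w).pivotLabel v = G.coPivotLabel v := by
  classical
  unfold pivotLabel coPivotLabel
  by_cases hl : v ∈ G.loops <;> simp [nonsimpleLocalComplement, Set.mem_symmDiff, hl, h]

/-- If `f` maps the elements labeled `phi` to elements labeled `phi`, then the fundamental circuits
with respect to these elements determine the adjacencies. -/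
theorem TransverseCycleIso.adj_iff {V V' : Type*} [Fintype V] [Fintype V'] {G : LoopedGraph V}
    {H : LoopedGraph V'} {f : IsotropicElement V ≃ IsotropicElement V'}
    (h : G.TransverseCycleIso H f) (π : V ≃ V') (hπ : ∀ w, (f w).1 = π w.1)
    (hphi : ∀ v, f (v, phi) = (π v, phi)) (u v : V) : H.Adj (π u) (π v) ↔ G.Adj u v := by
  classical
  by_cases huv : u = v
  · subst huv
    simp
  have hc : Compatible f := fun w w' => by rw [hπ, hπ, π.injective.eq_iff]
  have hmem : G.neighborhoodCircuit v ∘ f.symm ∈ H.cycleSpace := by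
    rw [h]
    · convert G.neighborhoodCircuit_mem v
      ext w
      simp
    · convert hc.isSubtransversal_image (G.isSubtransversal_support_neighborhoodCircuit v)
      ext w
      simp [Equiv.image_eq_preimage_symm]
  have hphi' : ∀ v', f.symm (v', phi) = (π.symm v', phi) := by
    intro v'
    rw [Equiv.symm_apply_eq, hphi]
    simp
  have hne : ∀ v' a, a ≠ phi → (f.symm (v', a)).2 ≠ phi := by
    intro v' a ha h'
    have h1 : f.symm (v', a) = ((f.symm (v', a)).1, phi) := Prod.ext rfl h'
    rw [Equiv.symm_apply_eq, hphi] at h1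
    exact ha (congrArg Prod.snd h1)
  have hval : ∀ v' a, a ≠ phi → (G.neighborhoodCircuit v ∘ f.symm) (v', a) =
      if (v', a) = f (v, G.coPivotLabel v) then 1 else 0 := by
    intro v' a ha
    simp only [Function.comp_apply, neighborhoodCircuit, hne v' a ha, if_false,
      Equiv.symm_apply_eq]
  have hb : f (v, G.coPivotLabel v) = (π v, (f (v, G.coPivotLabel v)).2) :=
    Prod.ext (hπ _) rfl
  have hbne : (f (v, G.coPivotLabel v)).2 ≠ phi := by
    intro h'
    rw [h', ← hphi, f.injective.eq_iff] at hb
    exact G.coPivotLabel_ne_phi v (congrArg Prod.snd hb)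
  generalize (f (v, G.coPivotLabel v)).2 = b at hb hbne
  rw [hb] at hval
  have hsum : ∀ v', (G.neighborhoodCircuit v ∘ f.symm) (v', chi) +
      (G.neighborhoodCircuit v ∘ f.symm) (v', psi) = if v' = π v then 1 else 0 := by
    intro v'
    rw [hval _ _ (by simp), hval _ _ (by simp)]
    cases b
    · exact absurd rfl hbne
    · simp
    · simp
  -- The transported circuit has a single element outside phi, located at `π v`. The equation at `π
  -- u` therefore says that the two adjacency indicators sum to zero.
  have := (mem_cycleSpace _ _).1 hmem (π u)
  have huv' : π u ≠ π v := fun h' => huv (π.injective h')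
  simp only [hsum, mul_ite, mul_one, mul_zero, Finset.sum_ite_eq', Finset.mem_univ, if_true] at this
  rw [hval (π u) psi (by simp), if_neg (fun h' => huv' (congrArg Prod.fst h')), add_zero,
    Function.comp_apply, hphi', adjacencyMatrix_of_ne _ huv'] at this
  simp only [neighborhoodCircuit, Equiv.symm_apply_apply, if_true] at this
  rw [G.adj_comm v u] at this
  by_cases h1 : G.Adj u v <;> by_cases h2 : H.Adj (π u) (π v) <;> simp_all

/-- Here `t v` is the label that `f` sends to phi, and the induction is on the number of vertices
where it is not phi. A local complementation at such a vertex repairs it if `t v` is its pivot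
label; if no pivot label is available, a preliminary local complementation at a neighbor makes one
available. -/
theorem TransverseCycleIso.locallyEquivalentUpToIso_of_labels {V V' : Type*} [Fintype V]
    [Fintype V'] (H : LoopedGraph V') (π : V ≃ V') (n : ℕ) :
    ∀ (G : LoopedGraph V) (f : IsotropicElement V ≃ IsotropicElement V') (t : V → ColumnLabel),
      G.TransverseCycleIso H f → (∀ w, (f w).1 = π w.1) → (∀ v, f (v, t v) = (π v, phi)) →
      {v | t v ≠ phi}.ncard = n → G.LocallyEquivalentUpToIso H := by
  classical
  induction n using Nat.strong_induction_on with
  | _ n ih =>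
    have pivot_step : ∀ (G : LoopedGraph V) (f : IsotropicElement V ≃ IsotropicElement V')
        (t : V → ColumnLabel), G.TransverseCycleIso H f → (∀ w, (f w).1 = π w.1) →
        (∀ v, f (v, t v) = (π v, phi)) → {v | t v ≠ phi}.ncard = n →
        ∀ v, t v ≠ phi → t v = G.pivotLabel v → G.LocallyEquivalentUpToIso H := by
      intro G f t hf hπ ht hn v hv htv
      have hlt : {u | Function.update t v phi u ≠ phi}.ncard < n := by
        rw [← hn]
        refine Set.ncard_lt_ncard ⟨fun u hu => ?_, fun hsub => ?_⟩
        · by_cases huv : u = v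
          · simp [huv] at hu
          · simpa [huv] using hu
        · have := hsub hv
          simp at this
      obtain ⟨G', hG', hI⟩ := ih _ hlt (G.nonsimpleLocalComplement v) ((G.pivotSwap v).symm.trans f)
        (Function.update t v phi) ((G.cycleIso_pivotSwap v).symm.transverseCycleIso_trans hf)
        (fun w => by rw [pivotSwap_symm, Equiv.trans_apply, hπ, pivotSwap_fst]) (fun u => by
          rw [pivotSwap_symm, Equiv.trans_apply, ← ht]
          by_cases huv : u = v
          · subst huv
            rw [Function.update_self, htv, pivotSwap, Equiv.swap_apply_left]
          · rw [Function.update_of_ne huv, pivotSwap_apply_of_ne _ huv]) rfl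
      exact ⟨G', Relation.ReflTransGen.head ⟨v, Or.inr (Or.inr rfl)⟩ hG', hI⟩
    intro G f t hf hπ ht hn
    by_cases hS : ∃ v, t v ≠ phi
    · obtain ⟨v, hv⟩ := hS
      by_cases hp : ∃ v, t v ≠ phi ∧ t v = G.pivotLabel v
      · obtain ⟨v, hv, hvp⟩ := hp
        exact pivot_step G f t hf hπ ht hn v hv hvp
      push Not at hp
      have hco : ∀ u, t u ≠ phi → t u = G.coPivotLabel u := fun u hu =>
        ((G.eq_phi_or_pivotLabel_or_coPivotLabel u (t u)).resolve_left hu).resolve_left (hp u hu)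
      -- If every neighbor of `v` had `t` equal to phi, the neighborhood circuit of `v` would
      -- consist of elements that `f` sends to phi, and the phi elements of `H` are independent.
      have hw : ∃ w, t w ≠ phi ∧ G.Adj w v := by
        by_contra hcon
        push Not at hcon
        have hsupp : ∀ w, G.neighborhoodCircuit v w ≠ 0 → w.2 = t w.1 := by
          intro w hw
          unfold neighborhoodCircuit at hw
          split_ifs at hw with h1 h2 h3
          · rw [h1]
            by_contra h4
            exact hcon _ (Ne.symm h4) h2.symm
          · simp at hw
          · rw [h3, hco v hv]
          · simp at hw
        have hmem : G.neighborhoodCircuit v ∘ f.symm ∈ H.cycleSpace := by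
          rw [hf]
          · convert G.neighborhoodCircuit_mem v
            ext w
            simp
          · intro w hw w' hw' hww
            have h1 := hsupp _ hw
            have h2 := hsupp _ hw'
            apply f.symm.injective
            have h3 : (f.symm w).1 = (f.symm w').1 := by
              apply π.injective
              rw [← hπ, ← hπ]
              simpa using hww
            exact Prod.ext h3 (by rw [h1, h2, h3])
        have hzero : ∀ w, w.2 ≠ phi → (G.neighborhoodCircuit v ∘ f.symm) w = 0 := by
          intro w hw
          by_contra h1
          have h2 := hsupp _ h1
          have h3 : f (f.symm w) = (π (f.symm w).1, phi) := by
            rw [← ht, ← h2]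
          rw [Equiv.apply_symm_apply] at h3
          exact hw (congrArg Prod.snd h3)
        have hrow := (mem_cycleSpace _ _).1 hmem (π v)
        rw [hzero (π v, psi) (by simp), ← ht v] at hrow
        simp only [fun u => hzero (u, chi) (by simp), fun u => hzero (u, psi) (by simp)] at hrow
        simp [neighborhoodCircuit, hco v hv, coPivotLabel_ne_phi] at hrow
      obtain ⟨w, hw, hwv⟩ := hw
      have hvw : v ≠ w := hwv.ne'
      -- Since `t w` is the co-pivot label of `w`, the exchange at `w` leaves `t` unchanged, while
      -- the toggled loop at `v` turns `t v` into the pivot label.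
      obtain ⟨G', hG', hI⟩ := pivot_step (G.nonsimpleLocalComplement w)
        ((G.pivotSwap w).symm.trans f) t
        ((G.cycleIso_pivotSwap w).symm.transverseCycleIso_trans hf)
        (fun w => by rw [pivotSwap_symm, Equiv.trans_apply, hπ, pivotSwap_fst]) (fun u => by
          rw [pivotSwap_symm, Equiv.trans_apply, ← ht]
          by_cases huw : u = w
          · subst huw
            rw [pivotSwap, Equiv.swap_apply_of_ne_of_ne]
            · simpa using hw
            · simpa using hp u hw
          · rw [pivotSwap_apply_of_ne _ huw]) hn v hv
        (by rw [pivotLabel_nonsimpleLocalComplement _ hwv, hco v hv])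
      exact ⟨G', Relation.ReflTransGen.head ⟨w, Or.inr (Or.inr rfl)⟩ hG', hI⟩
    · push Not at hS
      have hadj := hf.adj_iff π hπ (fun v => by rw [← ht, hS])
      -- The adjacencies already agree under `π`; the loops are adjusted freely by loop
      -- complementations.
      refine ⟨⟨G.toSimpleGraph, π ⁻¹' H.loops⟩, locallyEquivalent_of_toSimpleGraph_eq _ _ rfl,
        ⟨{ toEquiv := π, map_rel_iff' := hadj _ _, map_loops_iff := fun _ => Iff.rfl }⟩⟩

theorem TransverseCycleIso.locallyEquivalentUpToIso {V V' : Type*} [Fintype V] [Fintype V']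
    {G : LoopedGraph V} {H : LoopedGraph V'} {f : IsotropicElement V ≃ IsotropicElement V'}
    (h : G.TransverseCycleIso H f) (hf : Compatible f) : G.LocallyEquivalentUpToIso H := by
  let π : V ≃ V' :=
    { toFun := fun v => (f (v, phi)).1
      invFun := fun v => (f.symm (v, phi)).1
      left_inv := fun v => by
        have := (hf.symm ((f (v, phi)).1, phi) (f (v, phi))).2 rfl
        simpa using this
      right_inv := fun v => by
        have := (hf ((f.symm (v, phi)).1, phi) (f.symm (v, phi))).2 rfl
        simpa using this }
  have hπ : ∀ w, (f w).1 = π w.1 := fun w => (hf w (w.1, phi)).2 rfl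
  refine TransverseCycleIso.locallyEquivalentUpToIso_of_labels H π _ G f
    (fun v => (f.symm (π v, phi)).2) h hπ (fun v => ?_) rfl
  have : (v, (f.symm (π v, phi)).2) = f.symm (π v, phi) := by
    refine Prod.ext ?_ rfl
    have := hπ (f.symm (π v, phi))
    rw [Equiv.apply_symm_apply] at this
    exact π.injective this
  rw [this, Equiv.apply_symm_apply]

end LoopedGraph

/-! ### Two triple partitions in a binary space -/

/-- The indicator function of the fiber of `p` over `v`. -/
noncomputable def fiberIndicator {W V : Type*} (p : W → V) (v : V) : W → ZMod 2 :=
  open Classical in fun w => if p w = v then 1 else 0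

/-- The fibers of `p` have three elements each, and their indicator functions belong to `C`. -/
structure IsTriplePartition {W V : Type*} (C : Submodule (ZMod 2) (W → ZMod 2)) (p : W → V) :
    Prop where
  ncard_fiber : ∀ v, {w | p w = v}.ncard = 3
  fiberIndicator_mem : ∀ v, fiberIndicator p v ∈ C

/-- The subspace `C` is invariant under the permutation `g` of the coordinates. -/
def PreservesSubspace {W : Type*} (C : Submodule (ZMod 2) (W → ZMod 2)) (g : W ≃ W) : Prop :=
  ∀ c, c ∈ C ↔ c ∘ g ∈ C

theorem preservesSubspace_of_involutive {W : Type*} {C : Submodule (ZMod 2) (W → ZMod 2)}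
    {g : W ≃ W} (hg : ∀ w, g (g w) = w) (h : ∀ c ∈ C, c ∘ g ∈ C) : PreservesSubspace C g := by
  refine fun c => ⟨h c, fun hc => ?_⟩
  have := h _ hc
  rwa [Function.comp_assoc, (funext hg : g ∘ g = id)] at this

theorem IsTriplePartition.comp {W V : Type*} {C : Submodule (ZMod 2) (W → ZMod 2)} {p : W → V}
    (hp : IsTriplePartition C p) {g : W ≃ W} (hg : PreservesSubspace C g) :
    IsTriplePartition C (p ∘ g) := by
  refine ⟨fun v => ?_, fun v => (hg _).1 (hp.fiberIndicator_mem v)⟩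
  rw [← hp.ncard_fiber v]
  exact Set.ncard_congr (fun w _ => g w) (fun w h => h) (fun w w' _ _ h => g.injective h)
    (fun w h => ⟨g.symm w, by simpa using h, by simp⟩)

theorem IsTriplePartition.exists_fiber {W V : Type*} {C : Submodule (ZMod 2) (W → ZMod 2)}
    {p : W → V} (hp : IsTriplePartition C p) (x : W) :
    ∃ y z, x ≠ y ∧ x ≠ z ∧ y ≠ z ∧ ∀ w, p w = p x ↔ w = x ∨ w = y ∨ w = z := by
  obtain ⟨a, b, c, hab, hac, hbc, h⟩ := Set.ncard_eq_three.1 (hp.ncard_fiber (p x))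
  have h' : ∀ w, p w = p x ↔ w = a ∨ w = b ∨ w = c := fun w => by
    simpa using Set.ext_iff.1 h w
  rcases (h' x).1 rfl with rfl | rfl | rfl
  · exact ⟨b, c, hab, hac, hbc, h'⟩
  · exact ⟨a, c, hab.symm, hbc, hac, fun w => by rw [h' w]; tauto⟩
  · exact ⟨a, b, hac.symm, hbc.symm, hab, fun w => by rw [h' w]; tauto⟩

theorem IsTriplePartition.exists_fiber_of_pair {W V : Type*} {C : Submodule (ZMod 2) (W → ZMod 2)}
    {p : W → V} (hp : IsTriplePartition C p) {x y : W} (hxy : x ≠ y) (h : p y = p x) :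
    ∃ z, x ≠ z ∧ y ≠ z ∧ ∀ w, p w = p x ↔ w = x ∨ w = y ∨ w = z := by
  obtain ⟨a, b, hxa, hxb, hab, h'⟩ := hp.exists_fiber x
  rcases (h' y).1 h with rfl | rfl | rfl
  · exact absurd rfl hxy
  · exact ⟨b, hxb, hab, h'⟩
  · exact ⟨a, hxa, hab.symm, fun w => by rw [h' w]; tauto⟩

/-- The fiber of `p` over `v` is contained in a fiber of `q`. -/
def IsCommonFiber {W V V' : Type*} (p : W → V) (q : W → V') (v : V) : Prop :=
  ∀ x y, p x = v → p y = v → q x = q y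

/-- The hypothesis makes `x` and `y` parallel: transposing them changes `c` by a multiple of the
given vector. -/
theorem preservesSubspace_swap {W : Type*} [DecidableEq W] {C : Submodule (ZMod 2) (W → ZMod 2)}
    {x y : W} (hxy : x ≠ y) (h : Pi.single x 1 + Pi.single y 1 ∈ C) :
    PreservesSubspace C (Equiv.swap x y) := by
  refine preservesSubspace_of_involutive (fun w => by simp) fun c hc => ?_
  have : c ∘ Equiv.swap x y = c + (c x + c y) • (Pi.single x 1 + Pi.single y 1) := by
    ext w
    by_cases h1 : w = x
    · subst h1
      simp [hxy]
      grind
    · by_cases h2 : w = y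
      · subst h2
        simp [h1]
        grind
      · simp [h1, h2, Equiv.swap_apply_of_ne_of_ne]
  rw [this]
  exact C.add_mem hc (C.smul_mem _ h)

/-- If a fiber of `p` and a fiber of `q` have precisely two common elements, then the transposition
of the other two elements increases the set of common fibers. -/
theorem exists_preservesSubspace_of_pair {W V V' : Type*} {C : Submodule (ZMod 2) (W → ZMod 2)}
    {p : W → V} {q : W → V'} (hp : IsTriplePartition C p) (hq : IsTriplePartition C q) {x y z : W}
    (hxy : x ≠ y) (hpy : p y = p x) (hqy : q y = q x) (hpz : p z = p x) (hqz : q z ≠ q x) :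
    ∃ g : W ≃ W, PreservesSubspace C g ∧
      {v | IsCommonFiber p q v} ⊂ {v | IsCommonFiber p (q ∘ g) v} := by
  classical
  obtain ⟨z', hxz, hyz, hz⟩ := hp.exists_fiber_of_pair hxy hpy
  have hzz : z = z' := by
    rcases (hz z).1 hpz with rfl | rfl | rfl
    · exact absurd rfl hqz
    · exact absurd hqy hqz
    · rfl
  subst hzz
  obtain ⟨x', hxx, hyx, hx⟩ := hq.exists_fiber_of_pair hxy hqy
  have hzx : z ≠ x' := by
    rintro rfl
    exact hqz ((hx z).2 (by simp))
  have hqx : q x' = q x := (hx x').2 (by simp)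
  refine ⟨Equiv.swap z x', preservesSubspace_swap hzx ?_, fun v hv => ?_, fun hsub => ?_⟩
  -- In the sum of the two fiber indicators the shared elements `x` and `y` cancel, which leaves the
  -- pair `z`, `x'`.
  · convert C.add_mem (hp.fiberIndicator_mem (p x)) (hq.fiberIndicator_mem (q x)) using 1
    ext w
    have h1 := hz w
    have h2 := hx w
    have h11 : (1 + 1 : ZMod 2) = 0 := rfl
    simp only [Pi.add_apply, fiberIndicator, Pi.single_apply]
    by_cases hwx : w = x
    · subst hwx; simp [hxz, hxx, h11]
    by_cases hwy : w = y
    · subst hwy; simp [hyz, hyx, hpy, hqy, h11]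
    by_cases hwz : w = z
    · subst hwz; simp [hzx, hpz, hqz]
    by_cases hwx' : w = x'
    · subst hwx'
      have : p w ≠ p x := by rw [Ne, h1]; tauto
      simp [hwz, this, hqx]
    · have h3 : p w ≠ p x := by rw [Ne, h1]; tauto
      have h4 : q w ≠ q x := by rw [Ne, h2]; tauto
      simp [hwz, hwx', h3, h4]
  · have hvx : v ≠ p x := by
      rintro rfl
      exact hqz (hv z x hpz rfl)
    -- A common fiber through `x'` would lie in the fiber of `q` consisting of `x`, `y` and `x'`,
    -- hence would contain `x` or `y`; but these belong to another fiber of `p`.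
    have hfix : ∀ w, p w = v → Equiv.swap z x' w = w := by
      intro w hw
      refine Equiv.swap_apply_of_ne_of_ne ?_ ?_
      · rintro rfl
        exact hvx (hw.symm.trans hpz)
      · rintro rfl
        obtain ⟨a, b, ha, hb, hab, h⟩ := hp.exists_fiber w
        have h1 : q a = q x := (hv a w (((h a).2 (by simp)).trans hw) hw).trans hqx
        have h2 : q b = q x := (hv b w (((h b).2 (by simp)).trans hw) hw).trans hqx
        have hax : a ≠ x := by rintro rfl; exact hvx (hw.symm.trans ((h a).2 (by simp)).symm)
        have hbx : b ≠ x := by rintro rfl; exact hvx (hw.symm.trans ((h b).2 (by simp)).symm)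
        have h3 := (hx a).1 h1
        have h4 := (hx b).1 h2
        grind
    intro a b ha hb
    simp only [Function.comp_apply, hfix a ha, hfix b hb]
    exact hv a b ha hb
  · have : IsCommonFiber p (q ∘ Equiv.swap z x') (p x) := by
      have key : ∀ w, p w = p x → q (Equiv.swap z x' w) = q x := by
        intro w hw
        rcases (hz w).1 hw with rfl | rfl | rfl
        · rw [Equiv.swap_apply_of_ne_of_ne hxz hxx]
        · rw [Equiv.swap_apply_of_ne_of_ne hyz hyx, hqy]
        · rw [Equiv.swap_apply_left, hqx]
      intro a b ha hb
      exact (key a ha).trans (key b hb).symm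
    exact hqz (hsub this z x hpz rfl)

/-! ### The cube configuration -/

/-- A cubic bipartite graph in which any two vertices on the right with a common neighbor have
precisely two common neighbors contains the cube, which is `K₄,₄` without a perfect matching. -/
theorem exists_cube_of_cubic {V V' : Type*} (M : V → V' → Prop)
    (hleft : ∀ v j, M v j → ∃ k l, j ≠ k ∧ j ≠ l ∧ k ≠ l ∧ ∀ i, M v i ↔ i = j ∨ i = k ∨ i = l)
    (hright : ∀ v j, M v j → ∃ u w, v ≠ u ∧ v ≠ w ∧ u ≠ w ∧ ∀ i, M i j ↔ i = v ∨ i = u ∨ i = w)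
    (hone : ∀ v j k, j ≠ k → M v j → M v k → ∃ u, u ≠ v ∧ M u j ∧ M u k)
    (hthree : ∀ j k u v w, j ≠ k → u ≠ v → u ≠ w → v ≠ w → M u j → M v j → M w j →
      M u k → M v k → M w k → False)
    {a : V} {j₀ : V'} (ha : M a j₀) :
    ∃ (τ : Fin 4 → V) (κ : Fin 4 → V'), ∀ i j, M (τ i) (κ j) ↔ i ≠ j := by
  obtain ⟨b', c', hab', hac', hbc', hj₀'⟩ := hright a j₀ ha
  obtain ⟨j₁, j₂, h01, h02, h12, hja⟩ := hleft a j₀ ha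
  have ha1 : M a j₁ := (hja _).2 (by simp)
  have ha2 : M a j₂ := (hja _).2 (by simp)
  obtain ⟨b, hba, hb0, hb1⟩ := hone a j₀ j₁ h01 ha ha1
  have hc : ∃ c, a ≠ c ∧ b ≠ c ∧ ∀ i, M i j₀ ↔ i = a ∨ i = b ∨ i = c := by
    rcases (hj₀' b).1 hb0 with rfl | rfl | rfl
    · exact absurd rfl hba
    · exact ⟨c', hac', hbc', hj₀'⟩
    · exact ⟨b', hab', hbc'.symm, fun i => by rw [hj₀' i]; tauto⟩
  obtain ⟨c, hac, hbc, hj₀⟩ := hc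
  have hc0 : M c j₀ := (hj₀ _).2 (by simp)
  -- Otherwise `a` and `b` have the same neighbors. A second neighbor `k` of `c` shares with `j₀`
  -- one of `a` and `b`, hence both, and thus all three neighbors of `j₀`.
  have hb2 : ¬ M b j₂ := by
    intro hb2
    obtain ⟨k, l, h0k, h0l, hkl, hjc⟩ := hleft c j₀ hc0
    have hck : M c k := (hjc _).2 (by simp)
    obtain ⟨v, hvc, hv0, hvk⟩ := hone c j₀ k h0k hc0 hck
    obtain ⟨m, n, h0m, h0n, hmn, hjb⟩ := hleft b j₀ hb0
    have hak : M a k ∧ M b k := by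
      have hb1' := (hjb _).1 hb1
      have hb2' := (hjb _).1 hb2
      rcases (hj₀ v).1 hv0 with rfl | rfl | rfl
      · refine ⟨hvk, ?_⟩
        rcases (hja _).1 hvk with h | h | h
        · exact absurd h.symm h0k
        · rw [h]; exact hb1
        · rw [h]; exact hb2
      · refine ⟨?_, hvk⟩
        rw [hja]
        have := (hjb _).1 hvk
        clear hone hthree hleft hright hjb hjc hj₀' hj₀ hja
        grind
      · exact absurd rfl hvc
    exact hthree j₀ k a b c h0k hba.symm hac hbc ha hb0 hc0 hak.1 hak.2 hck
  have hc1 : ¬ M c j₁ := fun h => hthree j₀ j₁ a b c h01 hba.symm hac hbc ha hb0 hc0 ha1 hb1 h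
  have hc2 : M c j₂ := by
    obtain ⟨v, hva, hv0, hv2⟩ := hone a j₀ j₂ h02 ha ha2
    rcases (hj₀ v).1 hv0 with rfl | rfl | rfl
    · exact absurd rfl hva
    · exact absurd hv2 hb2
    · exact hv2
  have hj₃ : ∃ j₃, j₀ ≠ j₃ ∧ j₁ ≠ j₃ ∧ M b j₃ := by
    obtain ⟨m, n, h0m, h0n, hmn, hjb⟩ := hleft b j₀ hb0
    rcases (hjb _).1 hb1 with h | h | h
    · exact absurd h.symm h01
    · exact ⟨n, h0n, h ▸ hmn, (hjb _).2 (by simp)⟩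
    · exact ⟨m, h0m, h ▸ hmn.symm, (hjb _).2 (by simp)⟩
  obtain ⟨j₃, h03, h13, hb3⟩ := hj₃
  have h23 : j₂ ≠ j₃ := by
    rintro rfl
    exact hb2 hb3
  have ha3 : ¬ M a j₃ := by
    intro h
    rcases (hja _).1 h with h | h | h
    · exact h03 h.symm
    · exact h13 h.symm
    · exact h23 h.symm
  have hc3 : M c j₃ := by
    obtain ⟨v, hvb, hv0, hv3⟩ := hone b j₀ j₃ h03 hb0 hb3
    rcases (hj₀ v).1 hv0 with rfl | rfl | rfl
    · exact absurd hv3 ha3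
    · exact absurd rfl hvb
    · exact hv3
  have hd : ∃ d, a ≠ d ∧ b ≠ d ∧ ∀ i, M i j₁ ↔ i = a ∨ i = b ∨ i = d := by
    obtain ⟨m, n, ham, han, hmn, hj₁⟩ := hright a j₁ ha1
    rcases (hj₁ b).1 hb1 with rfl | rfl | rfl
    · exact absurd rfl hba
    · exact ⟨n, han, hmn, hj₁⟩
    · exact ⟨m, ham, hmn.symm, fun i => by rw [hj₁ i]; tauto⟩
  obtain ⟨d, had, hbd, hj₁⟩ := hd
  have hd1 : M d j₁ := (hj₁ _).2 (by simp)
  have hcd : c ≠ d := by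
    rintro rfl
    exact hc1 hd1
  have hd0 : ¬ M d j₀ := by
    intro h
    rcases (hj₀ _).1 h with h | h | h
    · exact had h.symm
    · exact hbd h.symm
    · exact hcd h.symm
  have hd2 : M d j₂ := by
    obtain ⟨v, hva, hv1, hv2⟩ := hone a j₁ j₂ h12 ha1 ha2
    rcases (hj₁ v).1 hv1 with rfl | rfl | rfl
    · exact absurd rfl hva
    · exact absurd hv2 hb2
    · exact hv2
  have hd3 : M d j₃ := by
    obtain ⟨v, hvb, hv1, hv3⟩ := hone b j₁ j₃ h13 hb1 hb3
    rcases (hj₁ v).1 hv1 with rfl | rfl | rfl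
    · exact absurd hv3 ha3
    · exact absurd rfl hvb
    · exact hv3
  refine ⟨![d, c, b, a], ![j₀, j₁, j₂, j₃], fun i j => ?_⟩
  clear hone hthree hleft hright hj₀' hj₀ hja hj₁
  fin_cases i <;> fin_cases j <;> simp [*]

/-- If the elements lying in the fibers of `p` over four points and those in the fibers of `q` over
four points are indexed by the pairs `(i, j)` with `i ≠ j`, then the transposition of the index
pairs increases the set of common fibers. -/
theorem exists_preservesSubspace_of_cube {W V V' : Type*} [Fintype W] [Fintype V]
    {C : Submodule (ZMod 2) (W → ZMod 2)} {p : W → V} {q : W → V'} (hp : IsTriplePartition C p)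
    (hq : IsTriplePartition C q)
    (hgram : ∀ c ∈ C, ∀ d ∈ C,
      c ⬝ᵥ d = ∑ v, (c ⬝ᵥ fiberIndicator p v) * (d ⬝ᵥ fiberIndicator p v))
    {τ : Fin 4 → V} {κ : Fin 4 → V'} (hM : ∀ i j, (∃ w, p w = τ i ∧ q w = κ j) ↔ i ≠ j) :
    ∃ g : W ≃ W, PreservesSubspace C g ∧
      {v | IsCommonFiber p q v} ⊂ {v | IsCommonFiber p (q ∘ g) v} := by
  classical
  have hτ : Function.Injective τ := by
    intro i j h
    by_contra hij
    obtain ⟨w, hw⟩ := (hM i j).2 hij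
    exact (hM j j).1 ⟨w, h ▸ hw⟩ rfl
  have hκ : Function.Injective κ := by
    intro i j h
    by_contra hij
    obtain ⟨w, hw⟩ := (hM i j).2 hij
    exact (hM i i).1 ⟨w, h ▸ hw⟩ rfl
  have hex : ∀ i j, ∃ w, i ≠ j → p w = τ i ∧ q w = κ j := by
    intro i j
    by_cases hij : i = j
    · obtain ⟨w, -⟩ := (hM 0 1).2 (by decide)
      exact ⟨w, fun h => absurd hij h⟩
    · obtain ⟨w, hw⟩ := (hM i j).2 hij
      exact ⟨w, fun _ => hw⟩
  choose e he using hex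
  have hpe : ∀ i j, i ≠ j → p (e i j) = τ i := fun i j h => (he i j h).1
  have hqe : ∀ i j, i ≠ j → q (e i j) = κ j := fun i j h => (he i j h).2
  have hinj : ∀ i j k l, i ≠ j → k ≠ l → e i j = e k l → i = k ∧ j = l := by
    intro i j k l hij hkl h
    exact ⟨hτ (by rw [← hpe i j hij, h, hpe k l hkl]), hκ (by rw [← hqe i j hij, h, hqe k l hkl])⟩
  have hcard : ∀ i : Fin 4, ((Finset.univ : Finset (Fin 4)).erase i).card = 3 := by decide
  have hrow : ∀ i, Finset.univ.filter (fun w => p w = τ i) = (Finset.univ.erase i).image (e i) := by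
    intro i
    symm
    apply Finset.eq_of_subset_of_card_le
    · intro w hw
      obtain ⟨j, hj, rfl⟩ := Finset.mem_image.1 hw
      simpa using hpe i j (Finset.ne_of_mem_erase hj).symm
    · rw [Finset.card_image_of_injOn, hcard]
      · have := hp.ncard_fiber (τ i)
        rw [Set.ncard_eq_toFinset_card'] at this
        simpa using this.le
      · intro j hj k hk h
        exact (hinj i j i k (Finset.ne_of_mem_erase hj).symm (Finset.ne_of_mem_erase hk).symm h).2
  have hcol : ∀ j, Finset.univ.filter (fun w => q w = κ j) =
      (Finset.univ.erase j).image (fun i => e i j) := by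
    intro j
    symm
    apply Finset.eq_of_subset_of_card_le
    · intro w hw
      obtain ⟨i, hi, rfl⟩ := Finset.mem_image.1 hw
      simpa using hqe i j (Finset.ne_of_mem_erase hi)
    · rw [Finset.card_image_of_injOn, hcard]
      · have := hq.ncard_fiber (κ j)
        rw [Set.ncard_eq_toFinset_card'] at this
        simpa using this.le
      · intro i hi k hk h
        exact (hinj i j k j (Finset.ne_of_mem_erase hi) (Finset.ne_of_mem_erase hk) h).1
  have hprow : ∀ i w, p w = τ i → ∃ j, i ≠ j ∧ w = e i j := by
    intro i w hw
    have : w ∈ (Finset.univ.erase i).image (e i) := by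
      rw [← hrow]
      simpa using hw
    obtain ⟨j, hj, rfl⟩ := Finset.mem_image.1 this
    exact ⟨j, (Finset.ne_of_mem_erase hj).symm, rfl⟩
  have hqcol : ∀ j w, q w = κ j → ∃ i, i ≠ j ∧ w = e i j := by
    intro j w hw
    have : w ∈ (Finset.univ.erase j).image (fun i => e i j) := by
      rw [← hcol]
      simpa using hw
    obtain ⟨i, hi, rfl⟩ := Finset.mem_image.1 this
    exact ⟨i, Finset.ne_of_mem_erase hi, rfl⟩
  have hg : ∃ g : W ≃ W, (∀ w, g (g w) = w) ∧ (∀ i j, i ≠ j → g (e i j) = e j i) ∧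
      ∀ w, (∀ i j, i ≠ j → w ≠ e i j) → g w = w := by
    have hex : ∀ w, ∃ w', (∀ i j, i ≠ j → w = e i j → w' = e j i) ∧
        ((∀ i j, i ≠ j → w ≠ e i j) → w' = w) := by
      intro w
      by_cases h : ∃ i j, i ≠ j ∧ w = e i j
      · obtain ⟨i, j, hij, rfl⟩ := h
        refine ⟨e j i, fun k l hkl h => ?_, fun h => absurd rfl (h i j hij)⟩
        obtain ⟨rfl, rfl⟩ := hinj _ _ _ _ hij hkl h
        rfl
      · push Not at h
        exact ⟨w, fun i j hij hw => absurd hw (h i j hij), fun _ => rfl⟩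
    choose g hg using hex
    have h1 : ∀ i j, i ≠ j → g (e i j) = e j i := fun i j hij => (hg _).1 i j hij rfl
    have hgg : Function.Involutive g := by
      intro w
      by_cases h : ∃ i j, i ≠ j ∧ w = e i j
      · obtain ⟨i, j, hij, rfl⟩ := h
        rw [h1 i j hij, h1 j i hij.symm]
      · push Not at h
        rw [(hg w).2 h, (hg w).2 h]
    exact ⟨hgg.toPerm g, hgg, h1, fun w => (hg w).2⟩
  obtain ⟨g, hgg, hge, hgf⟩ := hg
  refine ⟨g, preservesSubspace_of_involutive hgg fun c hc => ?_, fun v hv => ?_, fun hsub => ?_⟩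
  · have hdotp : ∀ i, c ⬝ᵥ fiberIndicator p (τ i) = ∑ j, if j = i then 0 else c (e i j) := by
      intro i
      have h1 : c ⬝ᵥ fiberIndicator p (τ i) = ∑ w with p w = τ i, c w := by
        simp [dotProduct, fiberIndicator, Finset.sum_filter]
      rw [h1, hrow, Finset.sum_image, ← Finset.filter_ne', Finset.sum_filter]
      · exact Finset.sum_congr rfl fun j _ => by by_cases h : j = i <;> simp [h]
      · intro j hj k hk h
        exact (hinj i j i k (Finset.ne_of_mem_erase hj).symm (Finset.ne_of_mem_erase hk).symm h).2
    have hdotq : ∀ (d : W → ZMod 2) j, d ⬝ᵥ fiberIndicator q (κ j) =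
        ∑ i, if i = j then 0 else d (e i j) := by
      intro d j
      have h1 : d ⬝ᵥ fiberIndicator q (κ j) = ∑ w with q w = κ j, d w := by
        simp [dotProduct, fiberIndicator, Finset.sum_filter]
      rw [h1, hcol, Finset.sum_image, ← Finset.filter_ne', Finset.sum_filter]
      · exact Finset.sum_congr rfl fun i _ => by by_cases h : i = j <;> simp [h]
      · intro i hi k hk h
        exact (hinj i j k j (Finset.ne_of_mem_erase hi) (Finset.ne_of_mem_erase hk) h).1
    have hqp : ∀ j v, fiberIndicator q (κ j) ⬝ᵥ fiberIndicator p v =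
        ∑ i, if i = j then 0 else if v = τ i then 1 else 0 := by
      intro j v
      rw [dotProduct_comm, hdotq]
      refine Finset.sum_congr rfl fun i _ => ?_
      by_cases h : i = j
      · simp [h]
      · simp [h, fiberIndicator, hpe i j h, eq_comm]
    -- The Gram identity for `c` and a fiber of `q`: the sum of column `j` is the sum of all rows
    -- except row `j`.
    have hrel : ∀ j, (∑ i, if i = j then 0 else c (e i j)) =
        ∑ i, if i = j then 0 else ∑ k, if k = i then 0 else c (e i k) := by
      intro j
      rw [← hdotq, hgram c hc _ (hq.fiberIndicator_mem _)]
      simp only [hqp, Finset.mul_sum]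
      rw [Finset.sum_comm]
      refine Finset.sum_congr rfl fun i _ => ?_
      by_cases h : i = j
      · simp [h]
      · simp [h, hdotp]
    have hr0 := hrel 0
    have hr1 := hrel 1
    have hr2 := hrel 2
    have hr3 := hrel 3
    simp [Fin.sum_univ_four] at hr0 hr1 hr2 hr3
    set α : ZMod 2 := ∑ i, ∑ k, if k = i then 0 else c (e i k) with hα
    simp [Fin.sum_univ_four] at hα
    let P : Fin 4 → W → ZMod 2 := fun i => fiberIndicator p (τ i)
    let Q : Fin 4 → W → ZMod 2 := fun i => fiberIndicator q (κ i)
    have hP : ∀ i, P i ∈ C := fun i => hp.fiberIndicator_mem _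
    have hQ : ∀ i, Q i ∈ C := fun i => hq.fiberIndicator_mem _
    have hPe : ∀ i k l, k ≠ l → P i (e k l) = if k = i then 1 else 0 := by
      intro i k l hkl
      simp [P, fiberIndicator, hpe k l hkl, hτ.eq_iff]
    have hQe : ∀ i k l, k ≠ l → Q i (e k l) = if l = i then 1 else 0 := by
      intro i k l hkl
      simp [Q, fiberIndicator, hqe k l hkl, hκ.eq_iff]
    -- Let `s` assign to each edge `ij` of `K₄` the sum of `c` at `(i, j)` and `(j, i)`. By `hrel`
    -- its sum at each vertex is `α`, so `s + α` is a cycle of `K₄` and a combination of the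
    -- triangles through the vertex 3. The vector `Q 2 + (P 0 + P 1 + P 3)` represents the triangle
    -- 013, and likewise for the other two.
    have hformula : c ∘ g = c + (c (e 0 1) + c (e 1 0) + α) • (Q 2 + (P 0 + P 1 + P 3)) +
        (c (e 0 2) + c (e 2 0) + α) • (Q 1 + (P 0 + P 2 + P 3)) +
        (c (e 1 2) + c (e 2 1) + α) • (Q 0 + (P 1 + P 2 + P 3)) +
        α • (P 0 + P 1 + P 2 + P 3) := by
      ext w
      by_cases h : ∃ k l, k ≠ l ∧ w = e k l
      · obtain ⟨k, l, hkl, rfl⟩ := h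
        simp only [Function.comp_apply, hge k l hkl, Pi.add_apply, Pi.smul_apply, smul_eq_mul,
          hPe _ k l hkl, hQe _ k l hkl]
        clear hPe hQe hP hQ hrel hqp hdotq hdotp hge hgf hqcol hprow hcol hrow hcard hinj hpe hqe he
        fin_cases k <;> fin_cases l <;> simp at hkl ⊢ <;> grind
      · push Not at h
        have h1 : ∀ i, P i w = 0 := by
          intro i
          have : p w ≠ τ i := by
            intro hw
            obtain ⟨j, hj, hwe⟩ := hprow i w hw
            exact h i j hj hwe
          simp [P, fiberIndicator, this]
        have h2 : ∀ i, Q i w = 0 := by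
          intro j
          have : q w ≠ κ j := by
            intro hw
            obtain ⟨i, hi, hwe⟩ := hqcol j w hw
            exact h i j hi hwe
          simp [Q, fiberIndicator, this]
        simp [h1, h2, hgf w h]
    rw [hformula]
    exact C.add_mem (C.add_mem (C.add_mem (C.add_mem hc
      (C.smul_mem _ (C.add_mem (hQ _) (C.add_mem (C.add_mem (hP _) (hP _)) (hP _)))))
      (C.smul_mem _ (C.add_mem (hQ _) (C.add_mem (C.add_mem (hP _) (hP _)) (hP _)))))
      (C.smul_mem _ (C.add_mem (hQ _) (C.add_mem (C.add_mem (hP _) (hP _)) (hP _)))))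
      (C.smul_mem _ (C.add_mem (C.add_mem (C.add_mem (hP _) (hP _)) (hP _)) (hP _)))
  · have hfix : ∀ w, p w = v → g w = w := by
      intro w hw
      apply hgf
      rintro i j hij rfl
      rw [hpe i j hij] at hw
      -- A fiber of `p` in the cube meets several fibers of `q`, so it cannot already be common.
      obtain ⟨k, hki, hkj⟩ : ∃ k : Fin 4, i ≠ k ∧ j ≠ k := by
        clear hij hw
        decide +revert
      have := hv (e i j) (e i k) (by rw [hpe i j hij, hw]) (by rw [hpe i k hki, hw])
      rw [hqe i j hij, hqe i k hki] at this
      exact hkj (hκ this)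
    intro a b ha hb
    simp only [Function.comp_apply, hfix a ha, hfix b hb]
    exact hv a b ha hb
  · have : IsCommonFiber p (q ∘ g) (τ 0) := by
      have key : ∀ w, p w = τ 0 → q (g w) = κ 0 := by
        intro w hw
        obtain ⟨j, hj, rfl⟩ := hprow 0 w hw
        rw [hge 0 j hj, hqe j 0 hj.symm]
      intro a b ha hb
      exact (key a ha).trans (key b hb).symm
    have := hsub this (e 0 1) (e 0 2) (hpe _ _ (by decide)) (hpe _ _ (by decide))
    rw [hqe _ _ (by decide), hqe _ _ (by decide)] at this
    exact absurd (hκ this) (by decide)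

/-- Unless some intersection has size two, fibers of `p` and `q` meet in 0, 1 or 3 elements. Their
incidence graph away from the common fibers is then cubic, and the Gram identity supplies the parity
conditions that force a cube. -/
theorem exists_preservesSubspace_isCommonFiber_ssubset {W V V' : Type*} [Fintype W] [Fintype V]
    {C : Submodule (ZMod 2) (W → ZMod 2)} {p : W → V} {q : W → V'} (hp : IsTriplePartition C p)
    (hq : IsTriplePartition C q)
    (hgram : ∀ c ∈ C, ∀ d ∈ C,
      c ⬝ᵥ d = ∑ v, (c ⬝ᵥ fiberIndicator p v) * (d ⬝ᵥ fiberIndicator p v))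
    {v₀ : V} (hv₀ : ¬ IsCommonFiber p q v₀) :
    ∃ g : W ≃ W, PreservesSubspace C g ∧
      {v | IsCommonFiber p q v} ⊂ {v | IsCommonFiber p (q ∘ g) v} := by
  classical
  by_cases hpair : ∃ x y z, x ≠ y ∧ p y = p x ∧ q y = q x ∧ p z = p x ∧ q z ≠ q x
  · obtain ⟨x, y, z, hxy, hpy, hqy, hpz, hqz⟩ := hpair
    exact exists_preservesSubspace_of_pair hp hq hxy hpy hqy hpz hqz
  push Not at hpair
  have hcommon : ∀ x y, x ≠ y → p y = p x → q y = q x → IsCommonFiber p q (p x) :=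
    fun x y hxy hpy hqy a b ha hb =>
      (hpair x y a hxy hpy hqy ha).trans (hpair x y b hxy hpy hqy hb).symm
  have hdot : ∀ j v, fiberIndicator q j ⬝ᵥ fiberIndicator p v =
      if ∃ w, p w = v ∧ q w = j then 1 else 0 := by
    intro j v
    have h1 : fiberIndicator q j ⬝ᵥ fiberIndicator p v =
        (Finset.univ.filter (fun w => p w = v ∧ q w = j)).card := by
      rw [Finset.card_filter, Nat.cast_sum]
      refine Finset.sum_congr rfl fun w _ => ?_
      by_cases h1 : p w = v <;> by_cases h2 : q w = j <;> simp [fiberIndicator, h1, h2]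
    rw [h1]
    split_ifs with h
    · obtain ⟨x, rfl, rfl⟩ := h
      obtain ⟨y, z, hxy, hxz, hyz, hx⟩ := hp.exists_fiber x
      have hpy : p y = p x := (hx y).2 (by simp)
      have hpz : p z = p x := (hx z).2 (by simp)
      by_cases hqy : q y = q x
      · have : Finset.univ.filter (fun w => p w = p x ∧ q w = q x) = {x, y, z} := by
          ext w
          simp only [Finset.mem_filter, Finset.mem_univ, true_and, Finset.mem_insert,
            Finset.mem_singleton, ← hx, and_iff_left_iff_imp]
          exact fun hw => hpair x y w hxy hpy hqy hw
        rw [this, Finset.card_eq_three.2 ⟨x, y, z, hxy, hxz, hyz, rfl⟩]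
        rfl
      · have hqz : q z ≠ q x := fun hqz => hqy (hpair x z y hxz hpz hqz hpy)
        have : Finset.univ.filter (fun w => p w = p x ∧ q w = q x) = {x} := by
          ext w
          simp only [Finset.mem_filter, Finset.mem_univ, true_and, Finset.mem_singleton, hx]
          constructor
          · rintro ⟨rfl | rfl | rfl, hw⟩
            · rfl
            · exact absurd hw hqy
            · exact absurd hw hqz
          · rintro rfl
            simp
        rw [this]
        rfl
    · push Not at h
      rw [Finset.filter_false_of_mem (by simpa using h)]
      rfl
  -- Distinct fibers of `q` are disjoint, so the Gram identity says that an even number of fibers of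
  -- `p` meet both.
  have hsum : ∀ j k, j ≠ k → (∑ v, (if (∃ w, p w = v ∧ q w = j) ∧ ∃ w, p w = v ∧ q w = k
      then 1 else 0 : ZMod 2)) = 0 := by
    intro j k hjk
    have h1 := hgram _ (hq.fiberIndicator_mem j) _ (hq.fiberIndicator_mem k)
    have h2 : fiberIndicator q j ⬝ᵥ fiberIndicator q k = 0 := by
      refine Finset.sum_eq_zero fun w _ => ?_
      by_cases hw : q w = j
      · simp [fiberIndicator, hw, hjk]
      · simp [fiberIndicator, hw]
    rw [h2] at h1
    refine Eq.trans (Finset.sum_congr rfl fun v _ => ?_) h1.symm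
    rw [hdot, hdot, ite_and]
    split_ifs <;> simp
  let M : V → V' → Prop := fun v j => (∃ w, p w = v ∧ q w = j) ∧ ¬ IsCommonFiber p q v
  have hleft : ∀ v j, M v j →
      ∃ k l, j ≠ k ∧ j ≠ l ∧ k ≠ l ∧ ∀ i, M v i ↔ i = j ∨ i = k ∨ i = l := by
    rintro _ _ ⟨⟨x, rfl, rfl⟩, hbad⟩
    obtain ⟨y, z, hxy, hxz, hyz, hx⟩ := hp.exists_fiber x
    have hpy : p y = p x := (hx y).2 (by simp)
    have hpz : p z = p x := (hx z).2 (by simp)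
    refine ⟨q y, q z, fun h => hbad (hcommon x y hxy hpy h.symm),
      fun h => hbad (hcommon x z hxz hpz h.symm),
      fun h => hbad (hpy ▸ hcommon y z hyz (hpz.trans hpy.symm) h.symm), fun i => ?_⟩
    constructor
    · rintro ⟨⟨w, hw, rfl⟩, -⟩
      rcases (hx w).1 hw with rfl | rfl | rfl <;> simp
    · rintro (rfl | rfl | rfl)
      · exact ⟨⟨x, rfl, rfl⟩, hbad⟩
      · exact ⟨⟨y, hpy, rfl⟩, hbad⟩
      · exact ⟨⟨z, hpz, rfl⟩, hbad⟩
  -- A common fiber equals the fiber of `q` containing it, since both have three elements; it would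
  -- therefore contain `x`.
  have hbad_of : ∀ x w, ¬ IsCommonFiber p q (p x) → q w = q x → ¬ IsCommonFiber p q (p w) := by
    intro x w hbad hw hgood
    by_cases hxw : p x = p w
    · exact hbad (hxw ▸ hgood)
    obtain ⟨y, z, hwy, hwz, hyz, h⟩ := hp.exists_fiber w
    obtain ⟨a, b, hwa, hwb, hab, h'⟩ := hq.exists_fiber w
    have hpy : p y = p w := (h y).2 (by simp)
    have hpz : p z = p w := (h z).2 (by simp)
    have hy := (h' y).1 (hgood y w hpy rfl)
    have hz := (h' z).1 (hgood z w hpz rfl)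
    have hx := (h' x).1 hw.symm
    have hxw' : x ≠ w := by rintro rfl; exact hxw rfl
    have hxy' : x ≠ y := by rintro rfl; exact hxw hpy
    have hxz' : x ≠ z := by rintro rfl; exact hxw hpz
    clear h h' hdot hsum hgram hleft hcommon hpair
    grind
  have hright : ∀ v j, M v j →
      ∃ u w, v ≠ u ∧ v ≠ w ∧ u ≠ w ∧ ∀ i, M i j ↔ i = v ∨ i = u ∨ i = w := by
    rintro _ _ ⟨⟨x, rfl, rfl⟩, hbad⟩
    obtain ⟨y, z, hxy, hxz, hyz, hx⟩ := hq.exists_fiber x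
    have hqy : q y = q x := (hx y).2 (by simp)
    have hqz : q z = q x := (hx z).2 (by simp)
    have hby := hbad_of x y hbad hqy
    have hbz := hbad_of x z hbad hqz
    refine ⟨p y, p z, fun h => hbad (hcommon x y hxy h.symm hqy),
      fun h => hbad (hcommon x z hxz h.symm hqz),
      fun h => hby (hcommon y z hyz h.symm (hqz.trans hqy.symm)), fun i => ?_⟩
    constructor
    · rintro ⟨⟨w, rfl, hw⟩, -⟩
      rcases (hx w).1 hw with rfl | rfl | rfl <;> simp
    · rintro (rfl | rfl | rfl)
      · exact ⟨⟨x, rfl, rfl⟩, hbad⟩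
      · exact ⟨⟨y, rfl, hqy⟩, hby⟩
      · exact ⟨⟨z, rfl, hqz⟩, hbz⟩
  have hbad_two : ∀ v j k, j ≠ k → (∃ w, p w = v ∧ q w = j) → (∃ w, p w = v ∧ q w = k) →
      ¬ IsCommonFiber p q v := by
    rintro v _ _ hjk ⟨w, hw, rfl⟩ ⟨w', hw', rfl⟩ h
    exact hjk (h w w' hw hw')
  have hone : ∀ v j k, j ≠ k → M v j → M v k → ∃ u, u ≠ v ∧ M u j ∧ M u k := by
    intro v j k hjk hj hk
    by_contra hcon
    push Not at hcon
    have := hsum j k hjk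
    rw [Finset.sum_eq_single v] at this
    · rw [if_pos ⟨hj.1, hk.1⟩] at this
      exact one_ne_zero this
    · intro u _ huv
      refine if_neg fun h => ?_
      have hb := hbad_two u j k hjk h.1 h.2
      exact hcon u huv ⟨h.1, hb⟩ ⟨h.2, hb⟩
    · simp
  have hthree : ∀ j k u v w, j ≠ k → u ≠ v → u ≠ w → v ≠ w → M u j → M v j → M w j →
      M u k → M v k → M w k → False := by
    intro j k u v w hjk huv huw hvw huj hvj hwj huk hvk hwk
    have h := hsum j k hjk
    obtain ⟨a, b, hua, hub, hab, hj⟩ := hright u j huj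
    have hall : ∀ i, M i j → i = u ∨ i = v ∨ i = w := by
      intro i hi
      have h1 := (hj i).1 hi
      have h2 := (hj v).1 hvj
      have h3 := (hj w).1 hwj
      clear hj hdot hsum hgram hleft hcommon hpair hright hone hbad_two hbad_of h
      grind
    rw [← Finset.sum_subset (Finset.subset_univ {u, v, w})] at h
    · rw [Finset.sum_insert (by simp [huv, huw]), Finset.sum_insert (by simp [hvw]),
        Finset.sum_singleton, if_pos ⟨huj.1, huk.1⟩, if_pos ⟨hvj.1, hvk.1⟩,
        if_pos ⟨hwj.1, hwk.1⟩] at h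
      exact absurd h (by decide)
    · intro i _ hi
      refine if_neg fun h => hi ?_
      simpa using hall i ⟨h.1, hbad_two i j k hjk h.1 h.2⟩
  obtain ⟨x, hx⟩ : ∃ x, p x = v₀ := by
    by_contra hcon
    push Not at hcon
    exact hv₀ fun x _ h => absurd h (hcon x)
  obtain ⟨τ, κ, hM⟩ := exists_cube_of_cubic M hleft hright hone hthree (a := v₀) (j₀ := q x)
    ⟨⟨x, hx, rfl⟩, hv₀⟩
  refine exists_preservesSubspace_of_cube (τ := τ) (κ := κ) hp hq hgram fun i j => ?_
  rw [← hM]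
  refine ⟨fun h => ⟨h, ?_⟩, And.left⟩
  obtain ⟨k, hk⟩ : ∃ k, i ≠ k := ⟨i + 1, by simp⟩
  exact ((hM i k).2 hk).2

/-- If `C` satisfies the Gram identity with respect to the fibers of `p`, then some permutation that
preserves `C` maps the triple partition `p` to the triple partition `q`. -/
theorem exists_preservesSubspace_fiber_iff {W V V' : Type*} [Fintype W] [Fintype V]
    {C : Submodule (ZMod 2) (W → ZMod 2)} {p : W → V} (hp : IsTriplePartition C p)
    (hgram : ∀ c ∈ C, ∀ d ∈ C,
      c ⬝ᵥ d = ∑ v, (c ⬝ᵥ fiberIndicator p v) * (d ⬝ᵥ fiberIndicator p v))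
    {q : W → V'} (hq : IsTriplePartition C q) :
    ∃ g : W ≃ W, PreservesSubspace C g ∧ ∀ w w', q (g w) = q (g w') ↔ p w = p w' := by
  induction hn : {v | IsCommonFiber p q v}ᶜ.ncard using Nat.strong_induction_on generalizing q with
  | _ n ih =>
    by_cases hall : ∀ v, IsCommonFiber p q v
    -- All fibers have three elements, so inclusions of fibers are equalities.
    · refine ⟨Equiv.refl W, fun c => Iff.rfl, fun w w' => ⟨fun h => ?_, fun h => hall _ _ _ h rfl⟩⟩
      obtain ⟨y, z, hwy, hwz, hyz, hw⟩ := hp.exists_fiber w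
      obtain ⟨a, b, hwa, hwb, hab, hw'⟩ := hq.exists_fiber w
      have h1 := (hw' y).1 (hall (p w) y w ((hw y).2 (by simp)) rfl)
      have h2 := (hw' z).1 (hall (p w) z w ((hw z).2 (by simp)) rfl)
      have h3 := (hw' w').1 h.symm
      symm
      rw [hw]
      clear hgram ih hw hw'
      grind
    · push Not at hall
      obtain ⟨v₀, hv₀⟩ := hall
      obtain ⟨g, hg, hlt⟩ := exists_preservesSubspace_isCommonFiber_ssubset hp hq hgram hv₀
      obtain ⟨g', hg', hq'⟩ := ih _ (by
        rw [← hn]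
        exact Set.ncard_lt_ncard (compl_lt_compl_iff_lt.2 hlt)) (hq.comp hg) rfl
      exact ⟨g'.trans g, fun c => (hg c).trans (hg' _), hq'⟩

/-! ### The Gram identity and compatible isomorphisms -/

namespace LoopedGraph

open ColumnLabel IsotropicElement

theorem dotProduct_fiberIndicator_fst {V : Type*} [Fintype V] (c : IsotropicElement V → ZMod 2)
    (v : V) : c ⬝ᵥ fiberIndicator Prod.fst v = c (v, phi) + c (v, chi) + c (v, psi) := by
  classical
  simp [dotProduct, fiberIndicator, Fintype.sum_prod_type, sum_columnLabel,
    Finset.sum_add_distrib]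

/-- If `c` has zero sum on each triple, its kernel equation says that its chi part is the adjacency
matrix applied to its phi part. By symmetry of the matrix, the product with `d` becomes the phi part
of `c` paired with the kernel equations of `d`. -/
theorem dotProduct_eq_zero_of_mem_cycleSpace {V : Type*} [Fintype V] (G : LoopedGraph V)
    {c d : IsotropicElement V → ZMod 2} (hc : c ∈ G.cycleSpace) (hd : d ∈ G.cycleSpace)
    (h : ∀ v, c (v, phi) + c (v, chi) + c (v, psi) = 0) : c ⬝ᵥ d = 0 := by
  have hb : ∀ v, c (v, chi) + c (v, psi) = c (v, phi) := fun v => by grind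
  have ha : ∀ v, c (v, chi) = ∑ u, G.adjacencyMatrix v u * c (u, phi) := by
    intro v
    have h1 := (mem_cycleSpace _ _).1 hc v
    simp only [hb] at h1
    have h2 := h v
    generalize ∑ u, G.adjacencyMatrix v u * c (u, phi) = s at h1 ⊢
    grind
  have hdot : c ⬝ᵥ d = ∑ v, (c (v, phi) * (d (v, phi) + d (v, psi)) +
      c (v, chi) * (d (v, chi) + d (v, psi))) := by
    simp only [dotProduct, Fintype.sum_prod_type, sum_columnLabel]
    refine Finset.sum_congr rfl fun v _ => ?_
    have : c (v, psi) = c (v, phi) + c (v, chi) := by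
      have := h v
      grind
    rw [this]
    ring
  rw [hdot, Finset.sum_add_distrib]
  simp only [ha, Finset.sum_mul]
  rw [Finset.sum_comm, ← Finset.sum_add_distrib]
  refine Finset.sum_eq_zero fun u _ => ?_
  have h1 := (mem_cycleSpace _ _).1 hd u
  rw [← mul_zero (c (u, phi)), ← h1, mul_add (c (u, phi)) (_ + _) (Finset.sum _ _), Finset.mul_sum]
  congr 1
  refine Finset.sum_congr rfl fun v _ => ?_
  rw [adjacencyMatrix_symm G v u]
  ring

theorem isTriplePartition_fst {V : Type*} [Fintype V] (G : LoopedGraph V) :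
    IsTriplePartition G.cycleSpace (Prod.fst : IsotropicElement V → V) := by
  classical
  refine ⟨fun v => Set.ncard_eq_three.2
    ⟨(v, phi), (v, chi), (v, psi), by simp, by simp, by simp, ?_⟩, fun v => ?_⟩
  · ext w
    exact mem_vertexTriple.symm
  · rw [mem_cycleSpace]
    intro u
    have : ∀ a b : V, fiberIndicator Prod.fst v (a, chi) + fiberIndicator Prod.fst v (a, psi) = 0 :=
      fun a _ => CharTwo.add_self_eq_zero _
    simp only [this _ v, mul_zero, Finset.sum_const_zero, add_zero]
    exact CharTwo.add_self_eq_zero _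

/-- As triples have odd size, subtracting from `c` its triples with the coefficients shown makes all
triple sums vanish, and the remainder is orthogonal to `d`. -/
theorem dotProduct_eq_sum_of_mem_cycleSpace {V : Type*} [Fintype V] (G : LoopedGraph V) :
    ∀ c ∈ G.cycleSpace, ∀ d ∈ G.cycleSpace, c ⬝ᵥ d =
      ∑ v, (c ⬝ᵥ fiberIndicator Prod.fst v) * (d ⬝ᵥ fiberIndicator Prod.fst v) := by
  classical
  intro c hc d hd
  set y := c - ∑ v, (c ⬝ᵥ fiberIndicator Prod.fst v) • fiberIndicator Prod.fst v with hy
  have hymem : y ∈ G.cycleSpace := G.cycleSpace.sub_mem hc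
    (G.cycleSpace.sum_mem fun v _ =>
      G.cycleSpace.smul_mem _ (G.isTriplePartition_fst.fiberIndicator_mem v))
  have hyv : ∀ v, y (v, phi) + y (v, chi) + y (v, psi) = 0 := by
    intro v
    have : ∀ a, y (v, a) = c (v, a) - (c (v, phi) + c (v, chi) + c (v, psi)) := by
      intro a
      simp [hy, dotProduct_fiberIndicator_fst, fiberIndicator, Finset.sum_apply]
    rw [this, this, this]
    grind
  have h := G.dotProduct_eq_zero_of_mem_cycleSpace hymem hd hyv
  rw [hy, sub_dotProduct, sub_eq_zero, sum_dotProduct] at h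
  rw [h]
  refine Finset.sum_congr rfl fun v _ => ?_
  rw [smul_dotProduct, smul_eq_mul, dotProduct_comm d]

/-- The triples of `H`, pulled back along `f`, form a second triple partition of the cycle space of
`G`. An automorphism matching the two partitions is composed with `f`. -/
theorem CycleIso.exists_compatible {V V' : Type*} [Fintype V] [Fintype V'] {G : LoopedGraph V}
    {H : LoopedGraph V'} {f : IsotropicElement V ≃ IsotropicElement V'} (hf : G.CycleIso H f) :
    ∃ f', G.CycleIso H f' ∧ Compatible f' := by
  have hq : IsTriplePartition G.cycleSpace (fun w => (f w).1) := by
    refine ⟨fun v => ?_, fun v => (hf _).1 (H.isTriplePartition_fst.fiberIndicator_mem v)⟩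
    rw [← H.isTriplePartition_fst.ncard_fiber v]
    exact Set.ncard_congr (fun w _ => f w) (fun w h => h) (fun w w' _ _ h => f.injective h)
      (fun w h => ⟨f.symm w, by simpa using h, by simp⟩)
  obtain ⟨g, hg, hc⟩ := exists_preservesSubspace_fiber_iff G.isTriplePartition_fst
    G.dotProduct_eq_sum_of_mem_cycleSpace hq
  exact ⟨g.trans f, CycleIso.trans (G := G) (H := G) hg hf, hc⟩

/-! ### Transverse matroids and transversals -/

theorem Compatible.isTransversal_image {V V' : Type*}
    {f : IsotropicElement V ≃ IsotropicElement V'} (hf : Compatible f)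
    {T : Set (IsotropicElement V)} (hT : IsTransversal T) : IsTransversal (f '' T) := by
  intro v'
  obtain ⟨w, ⟨hw, hwv⟩, -⟩ := hT (f.symm (v', phi)).1
  have hwv' : (f w).1 = v' := by
    have := (hf w (f.symm (v', phi))).2 (mem_vertexTriple.1 hwv)
    simpa using this
  refine ⟨f w, ⟨⟨w, hw, rfl⟩, mem_vertexTriple.2 hwv'⟩, ?_⟩
  rintro _ ⟨⟨y, hy, rfl⟩, hyv⟩
  rw [isSubtransversal_of_isTransversal hT y hy w hw
    ((hf _ _).1 ((mem_vertexTriple.1 hyv).trans hwv'.symm))]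

theorem _root_.Matroid.mapEquiv_restrict {α β : Type*} (M : Matroid α) (f : α ≃ β) (R : Set α) :
    (M.restrict R).mapEquiv f = (M.mapEquiv f).restrict (f '' R) := by
  refine Matroid.ext_indep rfl fun I _ => ?_
  rw [Matroid.mapEquiv_indep_iff, Matroid.restrict_indep_iff, Matroid.restrict_indep_iff,
    Matroid.mapEquiv_indep_iff, f.symm_image_subset]

theorem _root_.Matroid.mapEquiv_isCircuit_iff {α β : Type*} (M : Matroid α) (f : α ≃ β)
    {C : Set β} : (M.mapEquiv f).IsCircuit C ↔ M.IsCircuit (f.symm '' C) := by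
  rw [Matroid.isCircuit_iff, Matroid.isCircuit_iff, Matroid.mapEquiv_dep_iff]
  refine and_congr_right fun _ => ⟨fun h D hD hDC => ?_, fun h D hD hDC => ?_⟩
  · rw [← h (D := f '' D) (by simpa using hD) (by
      rintro _ ⟨x, hx, rfl⟩
      obtain ⟨y, hy, rfl⟩ := hDC hx
      simpa using hy)]
    simp
  · exact f.symm.injective.image_injective
      (h ((M.mapEquiv_dep_iff).1 hD) (Set.image_mono hDC))

theorem IsMatroidIso.matchesTransverseMatroids {V V' : Type*} [Finite V] [Finite V']
    {G : LoopedGraph V} {H : LoopedGraph V'} {f : IsotropicElement V ≃ IsotropicElement V'}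
    (h : G.IsMatroidIso H f) (hf : Compatible f) : G.MatchesTransverseMatroids H f := by
  ext N
  constructor
  · rintro ⟨_, ⟨T, hT, rfl⟩, rfl⟩
    refine ⟨f '' T, hf.isTransversal_image hT, ?_⟩
    rw [← h]
    exact Matroid.mapEquiv_restrict _ _ _
  · rintro ⟨T, hT, rfl⟩
    refine ⟨_, ⟨f.symm '' T, hf.symm.isTransversal_image hT, rfl⟩, ?_⟩
    rw [← h]
    refine (Matroid.mapEquiv_restrict _ _ _).trans ?_
    rw [f.image_symm_image]

/-- The transversals, which are the ground sets of the transverse matroids, thus determine the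
vertex triples. -/
theorem ne_fst_iff_exists_isTransversal {V : Type*} {w w' : IsotropicElement V} (h : w ≠ w') :
    w.1 ≠ w'.1 ↔ ∃ T, IsTransversal T ∧ w ∈ T ∧ w' ∈ T := by
  constructor
  · intro hne
    have : IsSubtransversal {w, w'} := by
      rintro a (rfl | rfl) b (rfl | rfl) hab
      · rfl
      · exact absurd hab hne
      · exact absurd hab.symm hne
      · rfl
    obtain ⟨T, hT, hs⟩ := this.exists_isTransversal
    exact ⟨T, hT, hs (by simp), hs (by simp)⟩
  · rintro ⟨T, hT, hw, hw'⟩ he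
    exact h (isSubtransversal_of_isTransversal hT w hw w' hw' he)

theorem MatchesTransverseMatroids.compatible {V V' : Type*} [Finite V] [Finite V']
    {G : LoopedGraph V} {H : LoopedGraph V'} {f : IsotropicElement V ≃ IsotropicElement V'}
    (h : G.MatchesTransverseMatroids H f) : Compatible f := by
  have key : ∀ T, IsTransversal T → IsTransversal (f '' T) := by
    intro T hT
    have : (G.isotropicMatroid.restrict T).mapEquiv f ∈ H.transverseMatroids := by
      rw [← h]
      exact ⟨_, ⟨T, hT, rfl⟩, rfl⟩
    obtain ⟨T', hT', he⟩ := this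
    have : f '' T = T' := congrArg Matroid.E he
    rwa [this]
  have key' : ∀ T', IsTransversal T' → ∃ T, IsTransversal T ∧ f '' T = T' := by
    intro T' hT'
    have : H.isotropicMatroid.restrict T' ∈ (fun N => N.mapEquiv f) '' G.transverseMatroids := by
      rw [h]
      exact ⟨T', hT', rfl⟩
    obtain ⟨_, ⟨T, hT, rfl⟩, he⟩ := this
    exact ⟨T, hT, congrArg Matroid.E he⟩
  intro w w'
  by_cases hww : w = w'
  · simp [hww]
  rw [← not_iff_not, ← Ne, ← Ne, ne_fst_iff_exists_isTransversal hww,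
    ne_fst_iff_exists_isTransversal (f.injective.ne hww)]
  constructor
  · rintro ⟨T', hT', hw, hw'⟩
    obtain ⟨T, hT, rfl⟩ := key' T' hT'
    exact ⟨T, hT, f.injective.mem_set_image.1 hw, f.injective.mem_set_image.1 hw'⟩
  · rintro ⟨T, hT, hw, hw'⟩
    exact ⟨_, key T hT, ⟨w, hw, rfl⟩, ⟨w', hw', rfl⟩⟩

theorem MatchesTransverseMatroids.matchesTransverseCircuits {V V' : Type*} [Finite V] [Finite V']
    {G : LoopedGraph V} {H : LoopedGraph V'} {f : IsotropicElement V ≃ IsotropicElement V'}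
    (h : G.MatchesTransverseMatroids H f) : G.MatchesTransverseCircuits H f := by
  ext C
  constructor
  · rintro ⟨C, ⟨N, hN, hC⟩, rfl⟩
    refine ⟨N.mapEquiv f, ?_, ?_⟩
    · rw [← h]
      exact ⟨N, hN, rfl⟩
    · rw [Matroid.mapEquiv_isCircuit_iff]
      simpa using hC
  · rintro ⟨N', hN', hC⟩
    rw [← h] at hN'
    obtain ⟨N, hN, rfl⟩ := hN'
    exact ⟨f.symm '' C, ⟨N, hN, (N.mapEquiv_isCircuit_iff f).1 hC⟩, f.image_symm_image C⟩

end LoopedGraph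

theorem mainTheorem8 {V : Type*} {V' : Type*} [Finite V] [Finite V']
    (G : LoopedGraph V) (H : LoopedGraph V') :
    List.TFAE [
      G.LocallyEquivalentUpToIso H,
      ∃ f : IsotropicElement V ≃ IsotropicElement V',
        G.IsMatroidIso H f ∧ LoopedGraph.MatchesVertexTriples f,
      ∃ f : IsotropicElement V ≃ IsotropicElement V', G.IsMatroidIso H f,
      ∃ f : IsotropicElement V ≃ IsotropicElement V', G.MatchesTransverseMatroids H f,
      ∃ f : IsotropicElement V ≃ IsotropicElement V',
        LoopedGraph.MatchesVertexTriples f ∧ G.MatchesTransverseCircuits H f] := by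
  cases nonempty_fintype V
  cases nonempty_fintype V'
  simp only [LoopedGraph.matchesVertexTriples_iff]
  tfae_have 1 → 2 := by
    intro h
    obtain ⟨f, hf, hc⟩ := h.exists_cycleIso
    exact ⟨f, (LoopedGraph.isMatroidIso_iff G H f).2 hf, hc⟩
  tfae_have 2 → 3 := fun ⟨f, hf, _⟩ => ⟨f, hf⟩
  tfae_have 3 → 2 := by
    rintro ⟨f, hf⟩
    obtain ⟨f', hf', hc⟩ := ((LoopedGraph.isMatroidIso_iff G H f).1 hf).exists_compatible
    exact ⟨f', (LoopedGraph.isMatroidIso_iff G H f').2 hf', hc⟩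
  tfae_have 2 → 4 := fun ⟨f, hf, hc⟩ => ⟨f, hf.matchesTransverseMatroids hc⟩
  tfae_have 4 → 5 := fun ⟨f, hf⟩ => ⟨f, hf.compatible, hf.matchesTransverseCircuits⟩
  tfae_have 5 → 1 := fun ⟨_, hc, hf⟩ =>
    (hf.transverseCycleIso hc).locallyEquivalentUpToIso hc
  tfae_finish
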